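/- All walks and paths are tight: for $k\ge 2$, a path in a $k$-uniform hypergraph $H$ with finite vertex set $V(H)$ is a sequence of distinct vertices in which every $k$ consecutive ones form an edge. The length of a path is its number of edges. An $abc$-$xyz$-path with $m$ inner vertices is a path of the form $abc\,w_1\dots w_m\,xyz$. For a $4$-uniform hypergraph $H=(V,E)$, $\delta_2(H)$ is the minimum, over all pairs of distinct vertices, of the number of edges containing the pair. For distinct $u,v\in V$, $H_{uv}$ is the graph on $V$ with edge set $\{xy : uvxy\in E\}$. For $v\in V$, $\overline H_v$ is the $3$-uniform hypergraph on $V\setminus\{v\}$ with edge set $\{xyz: vxyz\in E\}$. For a graph $G$, $e(G)$ is the number of edges of $G$, and for disjoint vertex sets $A,B$, $e_G(A,B)$ is the number of edges of $G$ with one end in $A$ and the other in $B$. A graph $R$ is $(\beta,\ell)$-robust if any two distinct vertices of $R$ are joined by at least $\beta|V(R)|^{\ell-1}$ paths of length $\ell$ in $R$. Let $\alpha\in(0,1/3)$, $\beta>0$, and let $\ell\ge 3$ be an odd integer. By the *setup* for a $4$-uniform hypergraph $H=(V,E)$ with $|V|=n$ we mean that $\delta_2(H)\ge(5/9+\alpha)n^2/2$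 and that for every pair $\{u,v\}$ of distinct vertices a $(\beta,\ell)$-robust induced subgraph $R_{uv}$ of $H_{uv}$ is fixed such that 1. $|V(R_{uv})|\ge(\frac23+\frac\alpha2)n$, 2. $e_{H_{uv}}(V(R_{uv}),V\setminus V(R_{uv}))\le\frac{\alpha^3}{18}n^2$, 3. $e(R_{uv})\ge(\frac59+\frac\alpha2)\frac{n^2}2-\frac{(n-|V(R_{uv})|)^2}2\ge(\frac49+\frac23\alpha)\frac{n^2}2$. Let $\zeta>0$. In the setup, a pair $xy$ of distinct vertices of $\overline H_v$ is $\zeta$-connectable in $\overline H_v$ if $xy\in E(R_{uv})$ for at least $\zeta(n-1)$ vertices $u\in V\setminus\{v\}$. A triple $(x,y,z)$ is a $\zeta$-bridge in $\overline H_v$ if $xyz\in E(\overline H_v)$ and both $xy$ and $yz$ are $\zeta$-connectable in $\overline H_v$. A triple $(x,y,z)\in V^3$ is $\zeta$-connectable in $H$ if it is a $\zeta$-bridge in $\overline H_v$ for at least $\zeta n$ vertices $v\in V$. **Statement.** For every odd integer $\ell\ge3$ there exist natural numbers $\ell_1,\ell_2,\ell_3,\ell_4\le 50\ell$ with $\ell_i\equiv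 i\pmod 4$ for all $i\in\{1,2,3,4\}$ such that for all $\alpha\in(0,1/3)$, $\beta>0$ and $\zeta>0$ there exist $\theta=\theta(\alpha,\beta,\ell,\zeta)>0$ and $n_0=n_0(\alpha,\beta,\ell,\zeta)$ with the following property. If the setup holds for a $4$-uniform hypergraph $H=(V,E)$ with $|V|=n\ge n_0$ vertices, and $(a,b,c)$ and $(x,y,z)$ are disjoint $\zeta$-connectable triples in $H$, then for every $i\in\{1,2,3,4\}$ the number of $abc$-$xyz$-paths in $H$ with $\ell_i$ inner vertices is at least $\theta n^{\ell_i}$. -/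

import Mathlib

/-- A `k`-uniform hypergraph with finite vertex set `verts ⊆ V`; its edges are `k`-element
subsets of the vertex set. For `k = 2` these are the finite simple graphs. -/
structure UniformHypergraph (k : ℕ) (V : Type*) where
  verts : Finset V
  edges : Finset (Finset V)
  subset_verts : ∀ e ∈ edges, e ⊆ verts
  card_eq : ∀ e ∈ edges, e.card = k

namespace UniformHypergraph

/-- The degree `d_H(S)`: the number of edges containing `S`. -/
def degree {k : ℕ} {V : Type*} [DecidableEq V] (H : UniformHypergraph k V) (S : Finset V) : ℕ :=
  (H.edges.filter (fun e => S ⊆ e)).card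

/-- The minimum `j`-degree `δ_j(H)`: the least degree of a `j`-element set of vertices. -/
noncomputable def minDegree {k : ℕ} {V : Type*} [DecidableEq V]
    (H : UniformHypergraph k V) (j : ℕ) : ℕ :=
  sInf (H.degree '' (H.verts.powersetCard j : Set (Finset V)))

/-- The link `H_v`: same vertex set, and `e` is an edge iff `v ∉ e` and `{v} ∪ e ∈ E(H)`. -/
def link {k : ℕ} {V : Type*} [DecidableEq V] (H : UniformHypergraph (k + 1) V) (v : V) :
    UniformHypergraph k V where
  verts := H.verts
  edges := (H.edges.filter (fun e => v ∈ e)).image (fun e => e.erase v)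
  subset_verts := by
    intro e he
    obtain ⟨f, hf, rfl⟩ := Finset.mem_image.1 he
    exact (Finset.erase_subset v f).trans (H.subset_verts f (Finset.mem_filter.1 hf).1)
  card_eq := by
    intro e he
    obtain ⟨f, hf, rfl⟩ := Finset.mem_image.1 he
    rw [Finset.card_erase_of_mem (Finset.mem_filter.1 hf).2,
      H.card_eq f (Finset.mem_filter.1 hf).1]
    rfl

/-- The link `H_{uv}` of a pair: same vertex set, and `e` is an edge iff it is disjoint from
`{u, v}` and `{u, v} ∪ e ∈ E(H)`. -/
def pairLink {k : ℕ} {V : Type*} [DecidableEq V] (H : UniformHypergraph (k + 2) V) (u v : V) :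
    UniformHypergraph k V :=
  (H.link u).link v

/-- `H - v`: delete the vertex `v` and all edges through it. -/
def deleteVertex {k : ℕ} {V : Type*} [DecidableEq V] (H : UniformHypergraph k V) (v : V) :
    UniformHypergraph k V where
  verts := H.verts.erase v
  edges := H.edges.filter (fun e => v ∉ e)
  subset_verts := by
    intro e he x hx
    obtain ⟨he, hv⟩ := Finset.mem_filter.1 he
    exact Finset.mem_erase.2 ⟨fun h => hv (h ▸ hx), H.subset_verts e he hx⟩
  card_eq := fun e he => H.card_eq e (Finset.mem_filter.1 he).1

/-- The hypergraph `H_v - v`, on the vertex set `V(H) \ {v}`. -/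
def reducedLink {k : ℕ} {V : Type*} [DecidableEq V] (H : UniformHypergraph (k + 1) V) (v : V) :
    UniformHypergraph k V :=
  (H.link v).deleteVertex v

/-- A (tight) walk: a sequence of vertices in which any `k` consecutive terms form an edge. -/
def IsWalk {k : ℕ} {V : Type*} [DecidableEq V] (H : UniformHypergraph k V) (l : List V) : Prop :=
  (∀ v ∈ l, v ∈ H.verts) ∧ ∀ s : List V, s <:+: l → s.length = k → s.toFinset ∈ H.edges

/-- A (tight) path: a walk all of whose vertices are distinct. -/
def IsPath {k : ℕ} {V : Type*} [DecidableEq V] (H : UniformHypergraph k V) (l : List V) : Prop :=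
  H.IsWalk l ∧ l.Nodup

/-- The number of (tight) paths that start with the sequence `p`, end with the sequence `q`, and
have exactly `m` inner vertices in between. -/
noncomputable def numPaths {k : ℕ} {V : Type*} [DecidableEq V] (H : UniformHypergraph k V)
    (p q : List V) (m : ℕ) : ℕ :=
  {w : Fin m → V | H.IsPath (p ++ List.ofFn w ++ q)}.ncard

/-- `R` is an induced subhypergraph of `G`. -/
def IsInduced {k : ℕ} {V : Type*} (R G : UniformHypergraph k V) : Prop :=
  R.verts ⊆ G.verts ∧ ∀ e : Finset V, e ∈ R.edges ↔ e ∈ G.edges ∧ e ⊆ R.verts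

/-- `e_G(A, B)` for a graph `G` and disjoint sets `A`, `B`: the number of edges with one end in `A`
and the other in `B`. -/
def edgesBetween {V : Type*} [DecidableEq V] (G : UniformHypergraph 2 V) (A B : Finset V) : ℕ :=
  (G.edges.filter (fun e => ∃ x ∈ A, ∃ y ∈ B, e = {x, y})).card

/-- A graph `R` is `(β, ℓ)`-robust (for `ℓ ≥ 1`) if any two distinct vertices `x`, `y` are joined by
at least `β |V(R)|^(ℓ-1)` paths of length `ℓ`, i.e. by that many paths with `ℓ - 1` inner
vertices. -/
def IsRobust {V : Type*} [DecidableEq V] (β : ℝ) (ℓ : ℕ) (R : UniformHypergraph 2 V) : Prop :=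
  ∀ x ∈ R.verts, ∀ y ∈ R.verts, x ≠ y →
    β * (R.verts.card : ℝ) ^ (ℓ - 1) ≤ (R.numPaths [x] [y] (ℓ - 1) : ℝ)

/-- `R` is a `(β, ℓ)`-robust induced subgraph of the graph `G` which is large, is joined to its
complement by at most `μ |V(G)|²` edges, and has many edges. -/
structure IsRobustPart {V : Type*} [DecidableEq V] (α μ β : ℝ) (ℓ : ℕ)
    (G R : UniformHypergraph 2 V) : Prop where
  induced : R.IsInduced G
  robust : R.IsRobust β ℓ
  card_verts : (2 / 3 + α / 2) * (G.verts.card : ℝ) ≤ (R.verts.card : ℝ)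
  cut : (G.edgesBetween R.verts (G.verts \ R.verts) : ℝ) ≤ μ * (G.verts.card : ℝ) ^ 2
  card_edges : (5 / 9 + α / 2) * ((G.verts.card : ℝ) ^ 2 / 2)
      - ((G.verts.card : ℝ) - (R.verts.card : ℝ)) ^ 2 / 2 ≤ (R.edges.card : ℝ)
  card_edges' : (4 / 9 + 2 / 3 * α) * ((G.verts.card : ℝ) ^ 2 / 2) ≤
      (5 / 9 + α / 2) * ((G.verts.card : ℝ) ^ 2 / 2)
        - ((G.verts.card : ℝ) - (R.verts.card : ℝ)) ^ 2 / 2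

/-- Given a 3-uniform hypergraph `F` and a graph `S v` for each vertex `v` of `F`, the pair `xy` of
distinct vertices is `ζ`-connectable if `xy ∈ E(S v)` for at least `ζ |V(F)|` vertices `v`. -/
def PairConnectable {V : Type*} [DecidableEq V] (F : UniformHypergraph 3 V)
    (S : V → UniformHypergraph 2 V) (ζ : ℝ) (x y : V) : Prop :=
  x ∈ F.verts ∧ y ∈ F.verts ∧ x ≠ y ∧
    ζ * (F.verts.card : ℝ) ≤
      ((F.verts.filter (fun v => ({x, y} : Finset V) ∈ (S v).edges)).card : ℝ)

/-- The triple `(x, y, z)` is a `ζ`-bridge in the 3-uniform hypergraph `F` (with respect to the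
graphs `S v`). -/
def IsBridge {V : Type*} [DecidableEq V] (F : UniformHypergraph 3 V)
    (S : V → UniformHypergraph 2 V) (ζ : ℝ) (x y z : V) : Prop :=
  ({x, y, z} : Finset V) ∈ F.edges ∧ F.PairConnectable S ζ x y ∧ F.PairConnectable S ζ y z

open Classical in
/-- Given a 4-uniform hypergraph `H` and a graph `R s(u, v)` for each pair of its vertices, the
triple `(x, y, z)` is `ζ`-connectable if it is a `ζ`-bridge in `H_v - v`, with respect to the graphs
`R s(u, v)`, for at least `ζ |V(H)|` vertices `v`. -/
def TripleConnectable {V : Type*} [DecidableEq V] (H : UniformHypergraph 4 V)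
    (R : Sym2 V → UniformHypergraph 2 V) (ζ : ℝ) (x y z : V) : Prop :=
  x ∈ H.verts ∧ y ∈ H.verts ∧ z ∈ H.verts ∧
    ζ * (H.verts.card : ℝ) ≤
      ((H.verts.filter (fun v =>
        (H.reducedLink v).IsBridge (fun u => R s(u, v)) ζ x y z)).card : ℝ)

end UniformHypergraph

section

open Finset

/-! Write `ℓ = 2h + 1`. A graph walk `Q₀Q₁Q₂…` inside a single `R_{uv}` becomes a tight walk of `H`
once the vertices `v, u` are inserted after every second term: each window of four consecutive
vertices then consists of `u`, `v` and an edge of `R_{uv}`. The inserted pair can be changed one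
vertex at a time, at an edge that lies in both of the graphs involved. Such edges are plentiful: the
bounds on the order and size of the `R_{uv}` force any two of these graphs to share at least `αn²`
ordered edges (`card_inter_ge`).

To join `abc` to `xyz`, choose `v, u` with `abcv` an edge and `bc` in `R_{uv}`, and `v', u'` with
`v'xyz` an edge and `xy` in `R_{u'v'}`; connectability supplies many choices. The inserted pair
changes from `{u,v}` to `{v,v'}` at a common edge `pq`, and from `{v,v'}` to `{u',v'}` at a common
edge `rs`. Robustness fills the three gaps, `c` to `p`, `q` to `r` and `s` to `x`, with `2h` inner
vertices each. As this number is even, both changes happen at the correct phase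
(`LinkSystem.connSeq_window`). The result has `12h + 10` inner vertices.

This walk repeats its inserted vertices, so counting the choices does not yet give the right power
of `n`. However, its letters have period 4 under a suitable colouring, hence are distinct in every
window. A blow-up argument based on Jensen's inequality gives every position its own copy of its
letter, and so produces a positive proportion of all sequences (`proportion_word_blowup`). Only
`O(1/n)` of the sequences fail to be paths (`proportion_not_nodup_le`).

For the remaining residues modulo 4, walks are concatenated through intermediate triples. A positive
proportion of all triples is connectable with the absolute constant `1/48`
(`LinkSystem.proportion_connectable_ge`), and each extra link adds `12h + 13` inner vertices, which
is 1 modulo 4. -/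

/-- The density of a predicate on a finite type. -/
noncomputable def proportion {X : Type*} [Fintype X] (P : X → Prop) : ℝ :=
  open Classical in ((univ.filter P).card : ℝ) / (Fintype.card X : ℝ)

/-! ### Calculus of densities -/

section Proportion

variable {X Y : Type*} [Fintype X] [Fintype Y]

theorem proportion_eq_sum (P : X → Prop) :
    proportion P = (∑ x, open Classical in if P x then (1 : ℝ) else 0) / (Fintype.card X : ℝ) := by
  classical
  simp [proportion]

theorem proportion_nonneg (P : X → Prop) : 0 ≤ proportion P := by
  unfold proportion; positivity

theorem proportion_mono {P Q : X → Prop} (h : ∀ x, P x → Q x) : proportion P ≤ proportion Q := by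
  classical
  unfold proportion
  gcongr with x
  exact h x

theorem proportion_le_one (P : X → Prop) : proportion P ≤ 1 := by
  classical
  unfold proportion
  apply div_le_one_of_le₀ _ (by positivity)
  exact_mod_cast card_le_univ _

theorem proportion_eq_zero {P : X → Prop} (h : ∀ x, ¬ P x) : proportion P = 0 := by
  simp [proportion, h]

theorem proportion_congr {P Q : X → Prop} (h : ∀ x, P x ↔ Q x) : proportion P = proportion Q := by
  rw [show P = Q from funext fun x => propext (h x)]

theorem proportion_true [Nonempty X] : proportion (fun _ : X => True) = 1 := by
  classical
  simp [proportion]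

theorem proportion_or_add_proportion_and (P Q : X → Prop) :
    proportion (fun x => P x ∨ Q x) + proportion (fun x => P x ∧ Q x) = proportion P + proportion Q := by
  classical
  simp only [proportion_eq_sum, ← add_div, ← sum_add_distrib]
  congr 1
  refine sum_congr rfl fun x _ => ?_
  by_cases hP : P x <;> by_cases hQ : Q x <;> simp [hP, hQ]

theorem proportion_le_and_add_not (P Q : X → Prop) :
    proportion P ≤ proportion (fun x => P x ∧ Q x) + proportion (fun x => P x ∧ ¬ Q x) := by
  rw [← proportion_or_add_proportion_and]
  have h := proportion_nonneg (fun x => (P x ∧ Q x) ∧ (P x ∧ ¬ Q x))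
  have h' : proportion P ≤ proportion (fun x => (P x ∧ Q x) ∨ (P x ∧ ¬ Q x)) :=
    proportion_mono fun x hx => by tauto
  linarith

theorem proportion_equiv (e : X ≃ Y) (P : Y → Prop) : proportion (fun x => P (e x)) = proportion P := by
  classical
  simp only [proportion_eq_sum, Fintype.card_congr e]
  congr 1
  exact Equiv.sum_comp e (fun y => if P y then (1 : ℝ) else 0)

theorem proportion_prod (P : X × Y → Prop) :
    proportion P = (∑ x, proportion (fun y => P (x, y))) / (Fintype.card X : ℝ) := by
  classical
  simp only [proportion_eq_sum, Fintype.sum_prod_type, Fintype.card_prod, Nat.cast_mul]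
  rw [← sum_div, div_div, mul_comm]

theorem proportion_prod_le {P : X × Y → Prop} {c : ℝ} (hc : 0 ≤ c)
    (h : ∀ x, proportion (fun y => P (x, y)) ≤ c) : proportion P ≤ c := by
  rw [proportion_prod]
  apply div_le_of_le_mul₀ (by positivity) hc
  calc ∑ x, proportion (fun y => P (x, y)) ≤ ∑ _x : X, c := sum_le_sum fun x _ => h x
    _ = c * Fintype.card X := by simp [mul_comm]

theorem proportion_prod_ge {P : X → Prop} {Q : X → Y → Prop} {c d : ℝ} (hd : 0 ≤ d)
    (hP : c ≤ proportion P) (hQ : ∀ x, P x → d ≤ proportion (Q x)) :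
    c * d ≤ proportion (fun z : X × Y => P z.1 ∧ Q z.1 z.2) := by
  classical
  calc c * d ≤ proportion P * d := by gcongr
    _ = (∑ x, if P x then d else 0) / (Fintype.card X : ℝ) := by
        rw [proportion_eq_sum, div_mul_eq_mul_div, sum_mul]
        simp
    _ ≤ _ := by
        rw [proportion_prod]
        gcongr with x
        split_ifs with h
        · exact (hQ x h).trans (proportion_mono fun y hy => ⟨h, hy⟩)
        · exact proportion_nonneg _

theorem proportion_fst [Nonempty Y] (P : X → Prop) : proportion (fun z : X × Y => P z.1) = proportion P := by
  classical
  rw [proportion_prod, proportion_eq_sum]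
  congr 1
  refine sum_congr rfl fun x _ => ?_
  by_cases h : P x
  · simpa [h] using proportion_true
  · rw [proportion_eq_zero fun y => h]
    simp [h]

/-- If a predicate on `X × Y` has density at least `2η`, then for a set of `x ∈ X` of density at
least `η` the section at `x` has density at least `η`. -/
theorem proportion_sections_ge {P : X × Y → Prop} {η : ℝ} (hη : 0 ≤ η) (h : 2 * η ≤ proportion P) :
    η ≤ proportion (fun x => η ≤ proportion (fun y => P (x, y))) := by
  have h₁ := proportion_le_and_add_not P (fun z => η ≤ proportion (fun y => P (z.1, y)))
  -- Sections of density below `η` account for at most `η` of the whole, leaving `η` for the rich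
  -- ones.
  have h₂ : proportion (fun z => P z ∧ ¬ η ≤ proportion (fun y => P (z.1, y))) ≤ η := by
    refine proportion_prod_le hη fun x => ?_
    by_cases hx : η ≤ proportion (fun y => P (x, y))
    · rw [proportion_eq_zero fun y hy => hy.2 hx]
      exact hη
    · exact (proportion_mono fun y hy => hy.1).trans (not_le.1 hx).le
  have h₃ : proportion (fun z : X × Y => P z ∧ η ≤ proportion (fun y => P (z.1, y))) ≤
      proportion (fun x => η ≤ proportion (fun y => P (x, y))) := by
    cases isEmpty_or_nonempty Y
    · rw [proportion_eq_zero fun z => isEmptyElim z.2]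
      exact proportion_nonneg _
    · rw [← proportion_fst (Y := Y) (fun x => η ≤ proportion (fun y => P (x, y)))]
      exact proportion_mono fun z hz => hz.2
  linarith

theorem proportion_comp_injective {V I J : Type*} [Fintype V] [Nonempty V] [Fintype I] [DecidableEq I]
    [Fintype J] [DecidableEq J] {σ : I → J} (hσ : Function.Injective σ) (P : (I → V) → Prop) :
    proportion (fun ψ : J → V => P (ψ ∘ σ)) = proportion P := by
  classical
  let e := Equiv.piEquivPiSubtypeProd (fun j => j ∈ Set.range σ) (fun _ => V)
  let e' : ({j // j ∈ Set.range σ} → V) ≃ (I → V) :=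
    Equiv.arrowCongr (Equiv.ofInjective σ hσ).symm (Equiv.refl V)
  have h₁ := proportion_equiv e (fun z => P (e' z.1))
  have h₂ : proportion (fun z : ({j // j ∈ Set.range σ} → V) × ({j // j ∉ Set.range σ} → V) =>
      P (e' z.1)) = proportion (fun z => P (e' z)) := proportion_fst (fun z => P (e' z))
  rw [← proportion_equiv e' P, ← h₂, ← h₁]
  rfl

theorem proportion_pi_forall {t : ℕ} (P : Fin t → X → Prop) :
    proportion (fun x : Fin t → X => ∀ j, P j (x j)) = ∏ j, proportion (P j) := by
  classical
  simp only [proportion, Fintype.card_fun, Fintype.card_fin, prod_div_distrib, prod_const,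
    card_univ, Nat.cast_pow]
  congr 1
  rw [← Nat.cast_prod, ← Fintype.card_piFinset]
  congr 2
  ext x
  simp

theorem proportion_eq_right (x : X) : proportion (fun y => y = x) = 1 / (Fintype.card X : ℝ) := by
  classical
  unfold proportion
  rw [card_eq_one.2 ⟨x, by ext; simp⟩, Nat.cast_one]

theorem proportion_swap (P : X × Y → Prop) :
    proportion (fun z : Y × X => P (z.2, z.1)) = proportion P :=
  proportion_equiv (Equiv.prodComm Y X) P

theorem proportion_snd [Nonempty X] (P : Y → Prop) :
    proportion (fun z : X × Y => P z.2) = proportion P := by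
  rw [← proportion_fst (Y := X) P, ← proportion_swap]

theorem proportion_sub_le (P Q : X → Prop) :
    proportion P - proportion (fun x => ¬ Q x) ≤ proportion (fun x => P x ∧ Q x) := by
  have h := proportion_le_and_add_not P Q
  have h' : proportion (fun x => P x ∧ ¬ Q x) ≤ proportion (fun x => ¬ Q x) :=
    proportion_mono fun x hx => hx.2
  linarith

theorem pow_average_le [Nonempty X] (f : X → ℝ) (hf : ∀ x, 0 ≤ f x) (t : ℕ) :
    ((∑ x, f x) / (Fintype.card X : ℝ)) ^ t ≤ (∑ x, f x ^ t) / (Fintype.card X : ℝ) := by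
  have hc : (Fintype.card X : ℝ) ≠ 0 := by simp
  have := Real.pow_arith_mean_le_arith_mean_pow univ (fun _ : X => 1 / (Fintype.card X : ℝ)) f
    (fun _ _ => by positivity) (by simp) (fun x _ => hf x) t
  simpa [← mul_sum, div_eq_inv_mul] using this

end Proportion

/-! ### Blow-up of predicates and words -/

/-- If a predicate on `V^k` has density `d`, then its `t`-fold blow-up has density at least
`d ^ (t ^ k)`. -/
theorem proportion_blowup {V : Type*} [Fintype V] [Nonempty V] (t k : ℕ) (g : (Fin k → V) → Prop) :
    proportion g ^ (t ^ k) ≤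
      proportion (fun ψ : Fin k → Fin t → V => ∀ s : Fin k → Fin t, g (fun i => ψ i (s i))) := by
  induction k with
  | zero =>
    simp only [pow_zero, pow_one]
    let e : (Fin 0 → V) ≃ (Fin 0 → Fin t → V) := Equiv.ofUnique _ _
    rw [← proportion_equiv e]
    refine proportion_mono fun x hx s => ?_
    convert hx
  | succ k ih =>
    -- Blow up the first coordinate alone, by Jensen over the other `k`. Then, for each fixed tuple
    -- `x` of its copies, apply induction to `g' x` and Jensen with exponent `t ^ k`.
    let g' : (Fin t → V) → (Fin k → V) → Prop := fun x y => ∀ j, g (Fin.cons (x j) y)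
    have h₁ : proportion g ^ t ≤ (∑ x, proportion (g' x)) / (Fintype.card (Fin t → V) : ℝ) := by
      have e₁ : proportion (fun z : (Fin t → V) × (Fin k → V) => g' z.1 z.2) =
          (∑ x, proportion (g' x)) / (Fintype.card (Fin t → V) : ℝ) := proportion_prod _
      rw [← e₁, ← proportion_equiv (Equiv.prodComm (Fin k → V) (Fin t → V)), proportion_prod,
        ← proportion_equiv (Fin.consEquiv (fun _ : Fin (k + 1) => V)) g,
        ← proportion_equiv (Equiv.prodComm (Fin k → V) V), proportion_prod]
      refine (pow_average_le _ (fun _ => proportion_nonneg _) t).trans (le_of_eq ?_)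
      congr 1
      refine sum_congr rfl fun y _ => ?_
      have := proportion_pi_forall (t := t) (fun _ v => g (Fin.cons v y))
      simp only [prod_const, card_univ, Fintype.card_fin] at this
      exact this.symm
    rw [← proportion_equiv (Fin.consEquiv (fun _ : Fin (k + 1) => Fin t → V)), proportion_prod]
    calc proportion g ^ (t ^ (k + 1)) = (proportion g ^ t) ^ (t ^ k) := by rw [← pow_mul, pow_succ']
      _ ≤ ((∑ x, proportion (g' x)) / (Fintype.card (Fin t → V) : ℝ)) ^ (t ^ k) := by
          gcongr
          exact pow_nonneg (proportion_nonneg _) _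
      _ ≤ (∑ x, proportion (g' x) ^ (t ^ k)) / (Fintype.card (Fin t → V) : ℝ) :=
          pow_average_le _ (fun _ => proportion_nonneg _) _
      _ ≤ _ := by
          gcongr with x
          refine (ih (g' x)).trans (proportion_mono fun ψ hψ s => ?_)
          have := hψ (fun i => s i.succ) (s 0)
          convert this using 1
          funext i
          refine Fin.cases ?_ (fun i => ?_) i <;> simp [Fin.consEquiv]

/-- Blow-up lemma for words: `K c` are constraints, each of which depends only on coordinates at
which the letters of the word `W` are distinct. If a positive proportion of the assignments of
vertices to letters obeys all constraints, then so does a positive proportion of all sequences. -/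
theorem proportion_word_blowup {V A ι : Type*} [Fintype V] [Nonempty V] [Fintype A] [DecidableEq A]
    {m : ℕ} (hm : 0 < m) (W : Fin m → A) (K : ι → (Fin m → V) → Prop) (C : ι → Set (Fin m))
    (hinj : ∀ c, Set.InjOn W (C c))
    (hdep : ∀ c w w', (∀ i ∈ C c, w i = w' i) → K c w → K c w') :
    proportion (fun φ : A → V => ∀ c, K c (φ ∘ W)) ^ (m ^ Fintype.card A) ≤
      proportion (fun w => ∀ c, K c w) := by
  classical
  let e := Fintype.equivFin A
  let g : (Fin (Fintype.card A) → V) → Prop := fun φ => ∀ c, K c (φ ∘ e ∘ W)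
  have h₁ : proportion (fun φ : A → V => ∀ c, K c (φ ∘ W)) = proportion g := by
    rw [← proportion_equiv (Equiv.arrowCongr e.symm (Equiv.refl V))]
    rfl
  rw [h₁]
  refine (proportion_blowup m _ g).trans ?_
  -- Each letter gets one copy per position of the word, and position `i` uses copy `i` of its
  -- letter; these coordinates are distinct, so they are distributed as a uniform sequence.
  have hσ : Function.Injective (fun i : Fin m => (e (W i), i)) := fun i j h => (Prod.ext_iff.1 h).2
  rw [← proportion_comp_injective hσ,
    ← proportion_equiv (Equiv.curry (Fin (Fintype.card A)) (Fin m) V).symm]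
  refine proportion_mono fun ψ hψ c => ?_
  -- For a single constraint, select for each letter the copy belonging to its unique position in `C
  -- c`; letters not occurring there get the irrelevant copy 0.
  let s : Fin (Fintype.card A) → Fin m := fun a =>
    if h : ∃ i ∈ C c, e (W i) = a then h.choose else ⟨0, hm⟩
  refine hdep c _ _ (fun i hi => ?_) (hψ s c)
  have h : ∃ j ∈ C c, e (W j) = e (W i) := ⟨i, hi, rfl⟩
  have : s (e (W i)) = i := by
    simp only [s, dif_pos h]
    exact hinj c h.choose_spec.1 hi (e.injective h.choose_spec.2)
  simp [this]

/-! ### Link systems and the connecting walk -/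

/-- The sequence `x, w₀, …, w_{k-1}, y, y, …`. -/
def pathSeq {T : Type*} {k : ℕ} (x : T) (w : Fin k → T) (y : T) (i : ℕ) : T :=
  if i = 0 then x else if h : i - 1 < k then w ⟨i - 1, h⟩ else y

/-- An abstract form of a 4-uniform hypergraph together with a graph `G u v` inside the link of
every pair of distinct vertices: any two of these graphs share a positive proportion of all pairs,
and any two distinct non-isolated vertices of such a graph are joined by a positive proportion of
all sequences with `k` terms. -/
structure LinkSystem (V : Type*) [Fintype V] (α β : ℝ) (k : ℕ) where
  E : V → V → V → V → Prop
  G : V → V → V → V → Prop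
  rot : ∀ {a b c d}, E a b c d → E b c d a
  ne : ∀ {u v p q}, G u v p q → u ≠ v
  symm : ∀ {u v p q}, G u v p q → G u v q p
  swap : ∀ {u v p q}, G u v p q → G v u p q
  edge : ∀ {u v p q}, G u v p q → E u v p q
  common : ∀ {u v u' v'}, u ≠ v → u' ≠ v' →
    α ≤ proportion (fun z : V × V => G u v z.1 z.2 ∧ G u' v' z.1 z.2)
  many : ∀ {u v}, u ≠ v → 4 / 9 ≤ proportion (fun z : V × V => G u v z.1 z.2)
  robust : ∀ {u v x x' y y'}, G u v x x' → G u v y y' → x ≠ y →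
    β ≤ proportion (fun w : Fin k → V => ∀ i ≤ k,
      G u v (pathSeq x w y i) (pathSeq x w y (i + 1)))

/-- The sequence `a, b, c, w₀, …, w_{m-1}, x, y, z, z, …`. -/
def padSeq {T : Type*} {m : ℕ} (a b c : T) (w : Fin m → T) (x y z : T) (i : ℕ) : T :=
  if i = 0 then a else if i = 1 then b else if i = 2 then c else
    if h : i - 3 < m then w ⟨i - 3, h⟩ else
      if i = m + 3 then x else if i = m + 4 then y else z

/-- The graph walk `b, c, w₀, p, q, w₁, r, s, w₂, x, y`. -/
def graphSeq {T : Type*} {h : ℕ} (b c x y p q r s : T) (w : Fin 3 → Fin (2 * h) → T) (n : ℕ) : T :=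
  if n = 0 then b else if n ≤ 2 * h + 2 then pathSeq c (w 0) p (n - 1)
    else if n ≤ 4 * h + 4 then pathSeq q (w 1) r (n - (2 * h + 3))
    else if n ≤ 6 * h + 6 then pathSeq s (w 2) x (n - (4 * h + 5)) else y

/-- The walk obtained from `graphSeq` by inserting pairs of the vertices `v, u, v', u'`. -/
def connSeq {T : Type*} {h : ℕ} (a b c x y z v u v' u' p q r s : T) (w : Fin 3 → Fin (2 * h) → T)
    (i : ℕ) : T :=
  if i = 0 then a
  else if (i - 1) % 4 = 0 then graphSeq b c x y p q r s w (2 * ((i - 1) / 4))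
  else if (i - 1) % 4 = 1 then graphSeq b c x y p q r s w (2 * ((i - 1) / 4) + 1)
  else if (i - 1) % 4 = 2 then
    (if (i - 1) / 4 ≤ 2 * h + 1 then v else if (i - 1) / 4 ≤ 3 * h + 2 then u' else z)
  else (if (i - 1) / 4 ≤ h then u else v')

namespace LinkSystem

variable {V : Type*} [Fintype V] {α β : ℝ} {k : ℕ}

/-- `w` is the inner part of a walk from `abc` to `xyz`. -/
def Walk (S : LinkSystem V α β k) {m : ℕ} (a b c : V) (w : Fin m → V) (x y z : V) : Prop :=
  ∀ i < m + 3, S.E (padSeq a b c w x y z i) (padSeq a b c w x y z (i + 1))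
    (padSeq a b c w x y z (i + 2)) (padSeq a b c w x y z (i + 3))

/-- `abc` is a bridge in the links of a proportion `κ` of all vertices. -/
def Connectable (S : LinkSystem V α β k) (κ : ℝ) (a b c : V) : Prop :=
  κ ≤ proportion (fun v => S.E a b c v ∧ κ ≤ proportion (fun u => S.G u v a b) ∧
    κ ≤ proportion (fun u => S.G u v b c))

theorem Connectable.mono {S : LinkSystem V α β k} {κ κ' : ℝ} (h : κ' ≤ κ) {a b c : V}
    (H : S.Connectable κ a b c) : S.Connectable κ' a b c :=
  (h.trans H).trans (proportion_mono fun _ hv => ⟨hv.1, h.trans hv.2.1, h.trans hv.2.2⟩)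

/-- The three ranges overlap exactly at the edges `pq` (index `2h + 2`) and `rs` (index `4h + 4`),
which belong to both neighbouring graphs; there the inserted pair may change. -/
theorem graphSeq_edges {h : ℕ} (S : LinkSystem V α β (2 * h)) {b c x y p q r s v u v' u' : V}
    {w : Fin 3 → Fin (2 * h) → V} (hbc : S.G u v b c) (hxy : S.G u' v' x y)
    (hpq : S.G u v p q) (hpq' : S.G v v' p q) (hrs : S.G v v' r s) (hrs' : S.G u' v' r s)
    (h₀ : ∀ i ≤ 2 * h, S.G u v (pathSeq c (w 0) p i) (pathSeq c (w 0) p (i + 1)))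
    (h₁ : ∀ i ≤ 2 * h, S.G v v' (pathSeq q (w 1) r i) (pathSeq q (w 1) r (i + 1)))
    (h₂ : ∀ i ≤ 2 * h, S.G u' v' (pathSeq s (w 2) x i) (pathSeq s (w 2) x (i + 1))) (n : ℕ) :
    (n ≤ 2 * h + 2 → S.G u v (graphSeq b c x y p q r s w n) (graphSeq b c x y p q r s w (n + 1))) ∧
    (2 * h + 2 ≤ n → n ≤ 4 * h + 4 →
      S.G v v' (graphSeq b c x y p q r s w n) (graphSeq b c x y p q r s w (n + 1))) ∧
    (4 * h + 4 ≤ n → n ≤ 6 * h + 6 →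
      S.G u' v' (graphSeq b c x y p q r s w n) (graphSeq b c x y p q r s w (n + 1))) := by
  have l₀ : ∀ n, 1 ≤ n → n ≤ 2 * h + 2 →
      graphSeq b c x y p q r s w n = pathSeq c (w 0) p (n - 1) := fun n hn hn' => by
    simp only [graphSeq]; rw [if_neg (by omega), if_pos hn']
  have l₁ : ∀ n, 2 * h + 3 ≤ n → n ≤ 4 * h + 4 →
      graphSeq b c x y p q r s w n = pathSeq q (w 1) r (n - (2 * h + 3)) := fun n hn hn' => by
    simp only [graphSeq]; rw [if_neg (by omega), if_neg (by omega), if_pos hn']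
  have l₂ : ∀ n, 4 * h + 5 ≤ n → n ≤ 6 * h + 6 →
      graphSeq b c x y p q r s w n = pathSeq s (w 2) x (n - (4 * h + 5)) := fun n hn hn' => by
    simp only [graphSeq]
    rw [if_neg (by omega), if_neg (by omega), if_neg (by omega), if_pos hn']
  have e₀ : ∀ (x y : V) (w : Fin (2 * h) → V), pathSeq x w y 0 = x := fun x y w => rfl
  have e₁ : ∀ (x y : V) (w : Fin (2 * h) → V), pathSeq x w y (2 * h + 1) = y := fun x y w => by
    simp [pathSeq]
  have d₁ : graphSeq b c x y p q r s w (2 * h + 2) = p := by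
    rw [l₀ _ (by omega) le_rfl]; exact e₁ _ _ _
  have d₂ : graphSeq b c x y p q r s w (2 * h + 2 + 1) = q := by
    rw [l₁ _ (by omega) (by omega), show 2 * h + 2 + 1 - (2 * h + 3) = 0 by omega]; exact e₀ _ _ _
  have d₃ : graphSeq b c x y p q r s w (4 * h + 4) = r := by
    rw [l₁ _ (by omega) le_rfl, show 4 * h + 4 - (2 * h + 3) = 2 * h + 1 by omega]; exact e₁ _ _ _
  have d₄ : graphSeq b c x y p q r s w (4 * h + 4 + 1) = s := by
    rw [l₂ _ (by omega) (by omega), show 4 * h + 4 + 1 - (4 * h + 5) = 0 by omega]; exact e₀ _ _ _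
  have d₅ : graphSeq b c x y p q r s w (6 * h + 6) = x := by
    rw [l₂ _ (by omega) le_rfl, show 6 * h + 6 - (4 * h + 5) = 2 * h + 1 by omega]; exact e₁ _ _ _
  have d₆ : graphSeq b c x y p q r s w (6 * h + 6 + 1) = y := by
    simp only [graphSeq]
    rw [if_neg (by omega), if_neg (by omega), if_neg (by omega), if_neg (by omega)]
  refine ⟨fun hn => ?_, fun hn hn' => ?_, fun hn hn' => ?_⟩
  · rcases Nat.eq_zero_or_pos n with rfl | hn₀
    · rw [l₀ (0 + 1) (by omega) (by omega)]
      exact hbc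
    rcases hn.eq_or_lt with rfl | hlt
    · rwa [d₁, d₂]
    · rw [l₀ _ hn₀ hn, l₀ _ (by omega) (by omega)]
      convert h₀ (n - 1) (by omega) using 2
      omega
  · rcases hn.eq_or_lt with rfl | hn₀
    · rwa [d₁, d₂]
    rcases hn'.eq_or_lt with rfl | hlt
    · rwa [d₃, d₄]
    · rw [l₁ _ (by omega) hn', l₁ _ (by omega) (by omega)]
      convert h₁ (n - (2 * h + 3)) (by omega) using 2
      omega
  · rcases hn.eq_or_lt with rfl | hn₀
    · rwa [d₃, d₄]
    rcases hn'.eq_or_lt with rfl | hlt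
    · rwa [d₅, d₆]
    · rw [l₂ _ (by omega) hn', l₂ _ (by omega) (by omega)]
      convert h₂ (n - (4 * h + 5)) (by omega) using 2
      omega

/-- Between the first window `abcv` and the last one `v'xyz`, each window consists of an edge of the
graph walk and two consecutive inserted vertices whose graph contains that edge. Both changes of
pair occur at edges starting at an even index, that is, between two inserted pairs. -/
theorem connSeq_window {h : ℕ} (S : LinkSystem V α β (2 * h))
    {a b c x y z v u v' u' p q r s : V} {w : Fin 3 → Fin (2 * h) → V}
    (habc : S.E a b c v) (hxyz : S.E v' x y z) (hbc : S.G u v b c) (hxy : S.G u' v' x y)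
    (hpq : S.G u v p q) (hpq' : S.G v v' p q) (hrs : S.G v v' r s) (hrs' : S.G u' v' r s)
    (h₀ : ∀ i ≤ 2 * h, S.G u v (pathSeq c (w 0) p i) (pathSeq c (w 0) p (i + 1)))
    (h₁ : ∀ i ≤ 2 * h, S.G v v' (pathSeq q (w 1) r i) (pathSeq q (w 1) r (i + 1)))
    (h₂ : ∀ i ≤ 2 * h, S.G u' v' (pathSeq s (w 2) x i) (pathSeq s (w 2) x (i + 1)))
    (i : ℕ) (hi : i < 12 * h + 13) :
    S.E (connSeq a b c x y z v u v' u' p q r s w i) (connSeq a b c x y z v u v' u' p q r s w (i + 1))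
      (connSeq a b c x y z v u v' u' p q r s w (i + 2))
      (connSeq a b c x y z v u v' u' p q r s w (i + 3)) := by
  have key := S.graphSeq_edges hbc hxy hpq hpq' hrs hrs' h₀ h₁ h₂
  set Q := graphSeq b c x y p q r s w with hQ
  let A : ℕ → V := fun j => if j ≤ 2 * h + 1 then v else if j ≤ 3 * h + 2 then u' else z
  let B : ℕ → V := fun j => if j ≤ h then u else v'
  -- `k₁` serves the windows that contain a whole inserted pair `A j, B j`; `k₂` serves those that
  -- straddle two pairs, containing `B j` and `A (j + 1)`.
  have k₁ : ∀ j n, j ≤ 3 * h + 2 → 2 * j ≤ n → n ≤ 2 * j + 2 →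
      S.G (A j) (B j) (Q n) (Q (n + 1)) := by
    intro j n hj hn hn'
    simp only [A, B]
    split_ifs
    · exact S.swap ((key n).1 (by omega))
    · exact (key n).2.1 (by omega) (by omega)
    · omega
    · exact (key n).2.2 (by omega) (by omega)
  have k₂ : ∀ j, j ≤ 3 * h + 1 → S.G (B j) (A (j + 1)) (Q (2 * j + 2)) (Q (2 * j + 2 + 1)) := by
    intro j hj
    simp only [A, B]
    split_ifs
    · exact (key _).1 (by omega)
    · omega
    · omega
    · exact S.swap ((key _).2.1 (by omega) (by omega))
    · exact S.swap ((key _).2.2 (by omega) (by omega))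
    · omega
  have f₀ : connSeq a b c x y z v u v' u' p q r s w 0 = a := rfl
  have f₁ : ∀ j, connSeq a b c x y z v u v' u' p q r s w (4 * j + 1) = Q (2 * j) := fun j => by
    simp only [connSeq]
    rw [if_neg (by omega), if_pos (by omega), show (4 * j + 1 - 1) / 4 = j by omega]
  have f₂ : ∀ j, connSeq a b c x y z v u v' u' p q r s w (4 * j + 2) = Q (2 * j + 1) := fun j => by
    simp only [connSeq]
    rw [if_neg (by omega), if_neg (by omega), if_pos (by omega),
      show (4 * j + 2 - 1) / 4 = j by omega]
  have f₃ : ∀ j, connSeq a b c x y z v u v' u' p q r s w (4 * j + 3) = A j := fun j => by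
    simp only [connSeq]
    rw [if_neg (by omega), if_neg (by omega), if_neg (by omega), if_pos (by omega),
      show (4 * j + 3 - 1) / 4 = j by omega]
  have f₄ : ∀ j, connSeq a b c x y z v u v' u' p q r s w (4 * j + 4) = B j := fun j => by
    simp only [connSeq]
    rw [if_neg (by omega), if_neg (by omega), if_neg (by omega), if_neg (by omega),
      show (4 * j + 4 - 1) / 4 = j by omega]
  rcases Nat.eq_zero_or_pos i with rfl | hi₀
  · rw [f₀, f₁ 0, f₂ 0, f₃ 0]
    simpa [A, hQ, graphSeq, pathSeq] using habc
  obtain ⟨j, hj⟩ : ∃ j, i = 4 * j + 1 ∨ i = 4 * j + 2 ∨ i = 4 * j + 3 ∨ i = 4 * j + 4 :=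
    ⟨(i - 1) / 4, by omega⟩
  rcases hj with rfl | rfl | rfl | rfl
  · rw [f₁, f₂, f₃, f₄]
    exact S.rot (S.rot (S.edge (k₁ j (2 * j) (by omega) (by omega) (by omega))))
  · rw [f₂, f₃, f₄, show 4 * j + 2 + 3 = 4 * (j + 1) + 1 by ring, f₁]
    exact S.rot (S.rot (S.rot (S.edge
      (S.symm (k₁ j (2 * j + 1) (by omega) (by omega) (by omega))))))
  · rw [f₃, f₄, show 4 * j + 3 + 2 = 4 * (j + 1) + 1 by ring, f₁,
      show 4 * j + 3 + 3 = 4 * (j + 1) + 2 by ring, f₂]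
    exact S.edge (k₁ j (2 * j + 2) (by omega) (by omega) (by omega))
  · rw [f₄, show 4 * j + 4 + 1 = 4 * (j + 1) + 1 by ring, f₁,
      show 4 * j + 4 + 2 = 4 * (j + 1) + 2 by ring, f₂,
      show 4 * j + 4 + 3 = 4 * (j + 1) + 3 by ring, f₃]
    -- For `j = 3h + 2` the next inserted vertex is already `z`, so the window is `v'xyz`.
    rcases (show j ≤ 3 * h + 2 by omega).eq_or_lt with rfl | hj
    · have d₅ : Q (2 * (3 * h + 2 + 1)) = x := by
        simp only [hQ, graphSeq]
        rw [if_neg (by omega), if_neg (by omega), if_neg (by omega), if_pos (by omega),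
          show 2 * (3 * h + 2 + 1) - (4 * h + 5) = 2 * h + 1 by omega]
        simp [pathSeq]
      have d₆ : Q (2 * (3 * h + 2 + 1) + 1) = y := by
        simp only [hQ, graphSeq]
        rw [if_neg (by omega), if_neg (by omega), if_neg (by omega), if_neg (by omega)]
      rw [d₅, d₆]
      simp only [A, B]
      rwa [if_neg (by omega), if_neg (by omega), if_neg (by omega)]
    · exact S.rot (S.edge (S.swap (k₂ j (by omega))))

end LinkSystem

/-! ### The word underlying the connecting walk -/

theorem map_pathSeq {T T' : Type*} (f : T → T') {k : ℕ} (x : T) (w : Fin k → T) (y : T) (i : ℕ) :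
    f (pathSeq x w y i) = pathSeq (f x) (f ∘ w) (f y) i := by
  unfold pathSeq
  split_ifs <;> rfl

theorem map_graphSeq {T T' : Type*} (f : T → T') {h : ℕ} (b c x y p q r s : T)
    (w : Fin 3 → Fin (2 * h) → T) (n : ℕ) :
    f (graphSeq b c x y p q r s w n) =
      graphSeq (f b) (f c) (f x) (f y) (f p) (f q) (f r) (f s) (fun i k => f (w i k)) n := by
  unfold graphSeq
  split_ifs <;> first | rfl | exact map_pathSeq f _ _ _ _

theorem map_connSeq {T T' : Type*} (f : T → T') {h : ℕ} (a b c x y z v u v' u' p q r s : T)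
    (w : Fin 3 → Fin (2 * h) → T) (i : ℕ) :
    f (connSeq a b c x y z v u v' u' p q r s w i) =
      connSeq (f a) (f b) (f c) (f x) (f y) (f z) (f v) (f u) (f v') (f u') (f p) (f q) (f r) (f s)
        (fun i k => f (w i k)) i := by
  unfold connSeq
  split_ifs <;> first | rfl | exact map_graphSeq f _ _ _ _ _ _ _ _ _ _

theorem graphSeq_inner {T : Type*} {h : ℕ} (b c x y b' c' x' y' p q r s : T)
    (w : Fin 3 → Fin (2 * h) → T) {n : ℕ} (hn : 2 ≤ n) (hn' : n ≤ 6 * h + 5) :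
    graphSeq b c x y p q r s w n = graphSeq b' c' x' y' p q r s w n := by
  unfold graphSeq pathSeq
  split_ifs <;> first | rfl | omega

theorem connSeq_inner {T : Type*} {h : ℕ} (a b c x y z a' b' c' x' y' z' v u v' u' p q r s : T)
    (w : Fin 3 → Fin (2 * h) → T) {i : ℕ} (hi : 3 ≤ i) (hi' : i < 12 * h + 13) :
    connSeq a b c x y z v u v' u' p q r s w i = connSeq a' b' c' x' y' z' v u v' u' p q r s w i := by
  unfold connSeq
  split_ifs <;> first | rfl | omega | exact graphSeq_inner _ _ _ _ _ _ _ _ _ _ _ _ _ (by omega) (by omega)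

theorem connSeq_last_fst {T : Type*} {h : ℕ} (a b c x y z v u v' u' p q r s : T)
    (w : Fin 3 → Fin (2 * h) → T) :
    connSeq a b c x y z v u v' u' p q r s w (12 * h + 13) = x := by
  rw [connSeq, if_neg (by omega), if_pos (by omega),
    show 2 * ((12 * h + 13 - 1) / 4) = 6 * h + 6 by omega, graphSeq, if_neg (by omega),
    if_neg (by omega), if_neg (by omega), if_pos (by omega), pathSeq, if_neg (by omega),
    dif_neg (by omega)]

theorem connSeq_last_snd {T : Type*} {h : ℕ} (a b c x y z v u v' u' p q r s : T)
    (w : Fin 3 → Fin (2 * h) → T) :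
    connSeq a b c x y z v u v' u' p q r s w (12 * h + 14) = y := by
  rw [connSeq, if_neg (by omega), if_neg (by omega), if_pos (by omega), graphSeq,
    if_neg (by omega), if_neg (by omega), if_neg (by omega), if_neg (by omega)]

theorem connSeq_last_thd {T : Type*} {h : ℕ} (a b c x y z v u v' u' p q r s : T)
    (w : Fin 3 → Fin (2 * h) → T) :
    connSeq a b c x y z v u v' u' p q r s w (12 * h + 15) = z := by
  rw [connSeq, if_neg (by omega), if_neg (by omega), if_neg (by omega), if_pos (by omega),
    if_neg (by omega), if_neg (by omega)]

/-- The letters of the word underlying `connSeq`. -/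
abbrev Letter (h : ℕ) : Type := Fin 8 ⊕ Fin 3 × Fin (2 * h)

/-- The inner letters of `connSeq`. -/
def connWord (h : ℕ) (i : Fin (12 * h + 10)) : Letter h :=
  -- The first six arguments are dummies for the end triples, on which the inner terms do not depend
  -- (`connSeq_inner`). The letters 0 to 7 stand for `v, u, v', u', p, q, r, s`.
  connSeq (Sum.inl 0) (Sum.inl 0) (Sum.inl 0) (Sum.inl 0) (Sum.inl 0) (Sum.inl 0) (Sum.inl 0)
    (Sum.inl 1) (Sum.inl 2) (Sum.inl 3) (Sum.inl 4) (Sum.inl 5) (Sum.inl 6) (Sum.inl 7)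
    (fun i k => Sum.inr (i, k)) (i + 3)

theorem padSeq_connWord {T : Type*} {h : ℕ} (a b c x y z : T) (φ : Letter h → T) {i : ℕ}
    (hi : i < 12 * h + 16) :
    padSeq a b c (φ ∘ connWord h) x y z i =
      connSeq a b c x y z (φ (Sum.inl 0)) (φ (Sum.inl 1)) (φ (Sum.inl 2)) (φ (Sum.inl 3))
        (φ (Sum.inl 4)) (φ (Sum.inl 5)) (φ (Sum.inl 6)) (φ (Sum.inl 7))
        (fun i k => φ (Sum.inr (i, k))) i := by
  rcases (show i = 0 ∨ i = 1 ∨ i = 2 ∨ i = 12 * h + 13 ∨ i = 12 * h + 14 ∨ i = 12 * h + 15 ∨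
    (3 ≤ i ∧ i < 12 * h + 13) by omega) with rfl | rfl | rfl | rfl | rfl | rfl | ⟨h₁, h₂⟩
  · rfl
  · rfl
  · simp [padSeq, connSeq, graphSeq, pathSeq]
  · rw [connSeq_last_fst, padSeq, if_neg (by omega), if_neg (by omega), if_neg (by omega),
      dif_neg (by omega), if_pos rfl]
  · rw [connSeq_last_snd, padSeq, if_neg (by omega), if_neg (by omega), if_neg (by omega),
      dif_neg (by omega), if_neg (by omega), if_pos rfl]
  · rw [connSeq_last_thd, padSeq, if_neg (by omega), if_neg (by omega), if_neg (by omega),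
      dif_neg (by omega), if_neg (by omega), if_neg (by omega)]
  · simp only [padSeq]
    rw [if_neg (by omega), if_neg (by omega), if_neg (by omega), dif_pos (by omega)]
    simp only [Function.comp, connWord, map_connSeq φ]
    rw [show i - 3 + 3 = i by omega]
    exact connSeq_inner _ _ _ _ _ _ _ _ _ _ _ _ _ _ _ _ _ _ _ _ _ h₁ h₂

/-- A colouring of the letters by which `connWord` is periodic with period `4`. -/
def letterColour {h : ℕ} : Letter h → ℕ
  | Sum.inl j => ![2, 3, 3, 2, 0, 1, 0, 1] j
  | Sum.inr (_, k) => k % 2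

theorem letterColour_connWord {h : ℕ} (i : Fin (12 * h + 10)) :
    letterColour (connWord h i) = (i + 2) % 4 := by
  obtain ⟨i, hi⟩ := i
  have hg : ∀ n, 2 ≤ n → n ≤ 6 * h + 5 →
      graphSeq 2 2 2 2 0 1 0 1 (fun (_ : Fin 3) (k : Fin (2 * h)) => (k : ℕ) % 2) n = n % 2 := by
    intro n hn hn'
    unfold graphSeq pathSeq
    dsimp only
    split_ifs <;> omega
  simp only [connWord, map_connSeq letterColour]
  simp only [letterColour, Matrix.cons_val]
  rcases (show (i + 3 - 1) % 4 = 0 ∨ (i + 3 - 1) % 4 = 1 ∨ (i + 3 - 1) % 4 = 2 ∨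
    (i + 3 - 1) % 4 = 3 by omega) with hi | hi | hi | hi
  · rw [connSeq, if_neg (by omega), if_pos hi]
    exact (hg _ (by omega) (by omega)).trans (by omega)
  · rw [connSeq, if_neg (by omega), if_neg (by omega), if_pos hi]
    exact (hg _ (by omega) (by omega)).trans (by omega)
  · rw [connSeq, if_neg (by omega), if_neg (by omega), if_neg (by omega), if_pos hi]
    simp only [ite_self]
    omega
  · rw [connSeq, if_neg (by omega), if_neg (by omega), if_neg (by omega), if_neg (by omega)]
    simp only [ite_self]
    omega

/-- The colours run through `0, 1, 2, 3` cyclically, so letters at distance below 4 differ. This is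
the injectivity that the blow-up needs. -/
theorem connWord_ne {h : ℕ} {i j : Fin (12 * h + 10)} (hij : (i : ℕ) < j) (hj : (j : ℕ) < i + 4) :
    connWord h i ≠ connWord h j := fun e => by
  have := congrArg letterColour e
  rw [letterColour_connWord, letterColour_connWord] at this
  omega

theorem padSeq_congr {T : Type*} {m : ℕ} (a b c x y z : T) {w w' : Fin m → T} {i : ℕ}
    (hw : ∀ j : Fin m, (j : ℕ) + 3 = i → w j = w' j) :
    padSeq a b c w x y z i = padSeq a b c w' x y z i := by
  unfold padSeq
  split_ifs <;> first | rfl | exact hw _ (by dsimp only; omega)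

/-! ### Counting connecting walks -/

namespace LinkSystem

variable {V : Type*} [Fintype V] {α β : ℝ} {k : ℕ}

/-- The blow-up applies because each edge condition involves at most four consecutive positions,
where the letters are distinct; the fixed vertices at the ends are not letters. -/
theorem proportion_walk_ge_of_letters [Nonempty V] {h : ℕ} (S : LinkSystem V α β (2 * h))
    (a b c x y z : V) :
    proportion (fun φ : Letter h → V => S.Walk a b c (φ ∘ connWord h) x y z) ^
        ((12 * h + 10) ^ Fintype.card (Letter h)) ≤
      proportion (fun w : Fin (12 * h + 10) → V => S.Walk a b c w x y z) := by
  refine proportion_word_blowup (by omega) (connWord h)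
    (fun (i : {i // i < 12 * h + 10 + 3}) w => S.E (padSeq a b c w x y z i)
      (padSeq a b c w x y z (i + 1)) (padSeq a b c w x y z (i + 2)) (padSeq a b c w x y z (i + 3)))
    (fun i => {j | (i : ℕ) ≤ j + 3 ∧ (j : ℕ) ≤ i}) ?_ ?_ |>.trans' ?_ |>.trans ?_
  · rintro ⟨i, hi⟩ j ⟨hj₁, hj₂⟩ l ⟨hl₁, hl₂⟩ e
    dsimp only at hj₁ hj₂ hl₁ hl₂
    rcases lt_trichotomy (j : ℕ) l with hjl | hjl | hjl
    · exact absurd e (connWord_ne hjl (by omega))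
    · exact Fin.ext hjl
    · exact absurd e.symm (connWord_ne hjl (by omega))
  · rintro ⟨i, hi⟩ w w' hw H
    dsimp only at H ⊢
    have e : ∀ l, i ≤ l → l ≤ i + 3 → padSeq a b c w x y z l = padSeq a b c w' x y z l :=
      fun l hl hl' => padSeq_congr _ _ _ _ _ _ fun j hj => hw j
        (show i ≤ (j : ℕ) + 3 ∧ (j : ℕ) ≤ i by omega)
    rwa [← e _ (by omega) (by omega), ← e _ (by omega) (by omega), ← e _ (by omega) (by omega),
      ← e _ (by omega) (by omega)]
  · exact pow_le_pow_left₀ (proportion_nonneg _) (proportion_mono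
      fun φ hφ (i : {i // i < 12 * h + 10 + 3}) => hφ i.1 i.2) _
  · exact proportion_mono fun w hw i hi => hw ⟨i, hi⟩

/-- Assignments of vertices to letters as tuples. -/
def letterEquiv (V : Type*) (h : ℕ) :
    ((((V × V) × (V × V)) × (V × V)) × (V × V)) × (Fin 3 → Fin (2 * h) → V) ≃
      (Letter h → V) where
  toFun t := Sum.elim ![t.1.1.1.1.1, t.1.1.1.1.2, t.1.1.1.2.1, t.1.1.1.2.2, t.1.1.2.1, t.1.1.2.2,
    t.1.2.1, t.1.2.2] (fun j => t.2 j.1 j.2)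
  invFun φ := (((((φ (Sum.inl 0), φ (Sum.inl 1)), (φ (Sum.inl 2), φ (Sum.inl 3))),
    (φ (Sum.inl 4), φ (Sum.inl 5))), (φ (Sum.inl 6), φ (Sum.inl 7))), fun i k => φ (Sum.inr (i, k)))
  left_inv t := rfl
  right_inv φ := by
    funext l
    rcases l with l | l
    · fin_cases l <;> rfl
    · rfl

theorem Connectable.proportion_pair_ge {S : LinkSystem V α β k} {κ : ℝ} (hκ : 0 ≤ κ) {a b c : V}
    (H : S.Connectable κ a b c) :
    κ * κ ≤ proportion (fun z : V × V => S.E a b c z.1 ∧ S.G z.2 z.1 b c) :=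
  (proportion_prod_ge (Q := fun v u => S.G u v b c) hκ H fun _ hv => hv.2.2).trans
    (proportion_mono fun _ hz => ⟨hz.1.1, hz.2⟩)

theorem Connectable.proportion_pair_ge' {S : LinkSystem V α β k} {κ : ℝ} (hκ : 0 ≤ κ) {x y z : V}
    (H : S.Connectable κ x y z) :
    κ * κ ≤ proportion (fun t : V × V => S.E t.1 x y z ∧ S.G t.2 t.1 x y) :=
  (proportion_prod_ge (Q := fun v u => S.G u v x y) hκ H fun _ hv => hv.2.1).trans
    (proportion_mono fun _ hz => ⟨S.rot (S.rot (S.rot hz.1.1)), hz.2⟩)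

/-- The letters are chosen in the order `(v, u)`, `(v', u')`, `(p, q)`, `(r, s)`, then the three
fillings. The conditions `v' ≠ v`, `p ≠ c`, `r ≠ q`, `s ≠ x`, required by the existence of `R_{vv'}`
and by robustness, each cost `1/n`. Two of them fall on the choice of `rs`, whence the bound `α/4`.
-/
theorem proportion_letters_ge [Nonempty V] {h : ℕ} (S : LinkSystem V α β (2 * h)) {κ : ℝ}
    (hκ : 0 < κ) (hα : 0 < α) (hβ : 0 ≤ β) {a b c x y z : V} (habc : S.Connectable κ a b c)
    (hxyz : S.Connectable κ x y z) (h₁ : 1 / (Fintype.card V : ℝ) ≤ κ * κ / 2)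
    (h₂ : 1 / (Fintype.card V : ℝ) ≤ α / 4) :
    (κ * κ * (κ * κ / 2) * (α / 2) * (α / 2)) * β ^ 3 ≤
      proportion (fun φ : Letter h → V => S.Walk a b c (φ ∘ connWord h) x y z) := by
  have ne_fst : ∀ v : V, proportion (fun z : V × V => ¬ z.1 ≠ v) = 1 / (Fintype.card V : ℝ) :=
    fun v => by
      simp only [not_not]
      rw [proportion_fst (fun y => y = v), proportion_eq_right]
  refine le_trans ?_ (proportion_equiv (letterEquiv V h) _).le
  have s₁ : κ * κ * (κ * κ / 2) ≤ proportion (fun t : (V × V) × (V × V) =>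
      (S.E a b c t.1.1 ∧ S.G t.1.2 t.1.1 b c) ∧
        (S.E t.2.1 x y z ∧ S.G t.2.2 t.2.1 x y) ∧ t.2.1 ≠ t.1.1) := by
    refine proportion_prod_ge (P := fun t : V × V => S.E a b c t.1 ∧ S.G t.2 t.1 b c)
      (Q := fun t t' : V × V =>
      (S.E t'.1 x y z ∧ S.G t'.2 t'.1 x y) ∧ t'.1 ≠ t.1) (by positivity)
      (habc.proportion_pair_ge hκ.le) fun t _ => ?_
    refine le_trans ?_ (proportion_sub_le _ _)
    rw [ne_fst]
    have := hxyz.proportion_pair_ge' hκ.le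
    linarith
  have s₂ := proportion_prod_ge (P := fun t : (V × V) × (V × V) =>
      (S.E a b c t.1.1 ∧ S.G t.1.2 t.1.1 b c) ∧
        (S.E t.2.1 x y z ∧ S.G t.2.2 t.2.1 x y) ∧ t.2.1 ≠ t.1.1)
      (Q := fun (t : (V × V) × (V × V)) (e : V × V) =>
      (S.G t.1.2 t.1.1 e.1 e.2 ∧ S.G t.1.1 t.2.1 e.1 e.2) ∧ e.1 ≠ c) (d := α / 2) (by positivity)
      s₁ fun t ht => by
    refine le_trans ?_ (proportion_sub_le _ _)
    rw [ne_fst]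
    have := S.common (S.ne ht.1.2) ht.2.2.symm
    linarith
  have s₃ := proportion_prod_ge
      (Q := fun (t : ((V × V) × (V × V)) × (V × V)) (e : V × V) =>
        ((S.G t.1.1.1 t.1.2.1 e.1 e.2 ∧ S.G t.1.2.2 t.1.2.1 e.1 e.2) ∧ e.1 ≠ t.2.2) ∧ e.2 ≠ x)
      (d := α / 2) (by positivity) s₂ fun t ht => by
    refine le_trans ?_ (proportion_sub_le _ _)
    have e₁ : proportion (fun z : V × V => ¬ z.2 ≠ x) = 1 / (Fintype.card V : ℝ) := by
      simp only [not_not]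
      rw [proportion_snd (fun y => y = x), proportion_eq_right]
    have e₂ := proportion_sub_le (fun e : V × V => S.G t.1.1.1 t.1.2.1 e.1 e.2 ∧
      S.G t.1.2.2 t.1.2.1 e.1 e.2) (fun e => e.1 ≠ t.2.2)
    rw [ne_fst] at e₂
    rw [e₁]
    have := S.common ht.1.2.2.symm (S.ne ht.1.2.1.2)
    linarith
  refine (proportion_prod_ge
      (Q := fun (t : (((V × V) × (V × V)) × (V × V)) × (V × V)) (w : Fin 3 → Fin (2 * h) → V) =>
        ∀ j, (![fun w => ∀ i ≤ 2 * h, S.G t.1.1.1.2 t.1.1.1.1 (pathSeq c w t.1.2.1 i)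
            (pathSeq c w t.1.2.1 (i + 1)),
          fun w => ∀ i ≤ 2 * h, S.G t.1.1.1.1 t.1.1.2.1 (pathSeq t.1.2.2 w t.2.1 i)
            (pathSeq t.1.2.2 w t.2.1 (i + 1)),
          fun w => ∀ i ≤ 2 * h, S.G t.1.1.2.2 t.1.1.2.1 (pathSeq t.2.2 w x i)
            (pathSeq t.2.2 w x (i + 1))] : Fin 3 → (Fin (2 * h) → V) → Prop) j (w j))
      (d := β ^ 3) (by positivity) s₃ fun t ht => ?_).trans (proportion_mono fun t ht => ?_)
  · rw [proportion_pi_forall, Fin.prod_univ_three, pow_three, ← mul_assoc]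
    obtain ⟨⟨⟨⟨_, hbc⟩, ⟨_, hxy⟩, _⟩, ⟨hpq, hpq'⟩, hpc⟩, ⟨⟨hrs, hrs'⟩, hrq⟩, hsx⟩ := ht
    have b₁ := S.robust (S.symm hbc) hpq hpc.symm
    have b₂ := S.robust (S.symm hpq') hrs hrq.symm
    have b₃ := S.robust (S.symm hrs') hxy hsx
    exact mul_le_mul (mul_le_mul b₁ b₂ hβ (proportion_nonneg _)) b₃ hβ
      (mul_nonneg (proportion_nonneg _) (proportion_nonneg _))
  · obtain ⟨⟨⟨⟨⟨hE, hbc⟩, ⟨hE', hxy⟩, _⟩, ⟨hpq, hpq'⟩, hpc⟩, ⟨⟨hrs, hrs'⟩, hrq⟩, hsx⟩, hw⟩ := ht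
    intro i hi
    rw [padSeq_connWord _ _ _ _ _ _ _ (by omega), padSeq_connWord _ _ _ _ _ _ _ (by omega),
      padSeq_connWord _ _ _ _ _ _ _ (by omega), padSeq_connWord _ _ _ _ _ _ _ (by omega)]
    exact S.connSeq_window hE hE' hbc hxy hpq hpq' hrs hrs' (hw 0) (hw 1) (hw 2) i hi

end LinkSystem

/-! ### Abundance of connectable triples and concatenation -/

/-- Inclusion–exclusion for the three rotated events: they have equal densities, and since `e` has
order dividing 3 so do their pairwise intersections. -/
theorem three_mul_proportion_le {X : Type*} [Fintype X] [Nonempty X] (e : X ≃ X)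
    (he : ∀ x, e (e (e x)) = x) (F : X → Prop) :
    3 * proportion F ≤ 1 + 3 * proportion (fun x => F x ∧ F (e x)) := by
  have h₁ := proportion_or_add_proportion_and F (fun x => F (e x))
  have h₂ := proportion_or_add_proportion_and (fun x => F x ∨ F (e x)) (fun x => F (e (e x)))
  have h₃ := proportion_or_add_proportion_and (fun x => F x ∧ F (e (e x)))
    (fun x => F (e x) ∧ F (e (e x)))
  have h₄ : proportion (fun x => (F x ∨ F (e x)) ∧ F (e (e x))) ≤
      proportion (fun x => (F x ∧ F (e (e x))) ∨ (F (e x) ∧ F (e (e x)))) :=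
    proportion_mono fun x hx => by tauto
  have h₅ := proportion_nonneg (fun x => (F x ∧ F (e (e x))) ∧ (F (e x) ∧ F (e (e x))))
  have h₆ := proportion_le_one (fun x => (F x ∨ F (e x)) ∨ F (e (e x)))
  have e₁ : proportion (fun x => F (e x)) = proportion F := proportion_equiv e F
  have e₂ : proportion (fun x => F (e (e x))) = proportion F :=
    (proportion_equiv e fun x => F (e x)).trans e₁
  have e₃ : proportion (fun x => F (e x) ∧ F (e (e x))) = proportion (fun x => F x ∧ F (e x)) :=
    proportion_equiv e fun x => F x ∧ F (e x)
  have e₄ : proportion (fun x => F x ∧ F (e (e x))) = proportion (fun x => F x ∧ F (e x)) := by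
    rw [← e₃, ← proportion_equiv e fun x => F (e x) ∧ F (e (e x))]
    exact proportion_congr fun x => by rw [he x, and_comm]
  linarith

theorem padSeq_inner {T : Type*} {m : ℕ} (a b c x y z : T) (w : Fin m → T) {i : ℕ} (hi : i < m) :
    padSeq a b c w x y z (i + 3) = w ⟨i, hi⟩ := by
  rw [padSeq, if_neg (by omega), if_neg (by omega), if_neg (by omega), dif_pos (by omega)]
  rfl

theorem padSeq_last {T : Type*} {m : ℕ} (a b c x y z : T) (w : Fin m → T) (i : ℕ) :
    padSeq a b c w x y z (m + 3 + i) = if i = 0 then x else if i = 1 then y else z := by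
  rw [padSeq, if_neg (by omega), if_neg (by omega), if_neg (by omega), dif_neg (by omega)]
  simp [add_assoc, show 3 + i = 4 ↔ i = 1 by omega]

theorem padSeq_append_left {T : Type*} {m m' : ℕ} (a b c x y z x' y' z' : T) (w : Fin m → T)
    (w' : Fin m' → T) {i : ℕ} (hi : i < m + 6) :
    padSeq a b c (Fin.append (Fin.append w ![x, y, z]) w') x' y' z' i =
      padSeq a b c w x y z i := by
  rcases lt_or_ge i 3 with h | h
  · unfold padSeq
    split_ifs <;> first | rfl | omega
  obtain ⟨i, rfl⟩ := Nat.exists_eq_add_of_le' h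
  rw [padSeq_inner _ _ _ _ _ _ _ (show i < m + 3 + m' by omega)]
  refine (Fin.append_left (Fin.append w ![x, y, z]) w' ⟨i, by omega⟩).trans ?_
  rcases lt_or_ge i m with h' | h'
  · rw [padSeq_inner _ _ _ _ _ _ _ h']
    exact Fin.append_left w ![x, y, z] ⟨i, h'⟩
  obtain ⟨i, rfl⟩ := Nat.exists_eq_add_of_le h'
  rw [show m + i + 3 = m + 3 + i by ring, padSeq_last]
  refine (Fin.append_right w ![x, y, z] ⟨i, by omega⟩).trans ?_
  have : i < 3 := by omega
  interval_cases i <;> rfl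

theorem padSeq_append_right {T : Type*} {m m' : ℕ} (a b c x y z x' y' z' : T) (w : Fin m → T)
    (w' : Fin m' → T) (i : ℕ) :
    padSeq a b c (Fin.append (Fin.append w ![x, y, z]) w') x' y' z' (m + 3 + i) =
      padSeq x y z w' x' y' z' i := by
  rcases lt_or_ge i 3 with h | h
  · rw [padSeq_append_left _ _ _ _ _ _ _ _ _ _ _ (by omega), padSeq_last]
    interval_cases i <;> rfl
  obtain ⟨i, rfl⟩ := Nat.exists_eq_add_of_le' h
  rcases lt_or_ge i m' with h' | h'
  · rw [padSeq_inner _ _ _ _ _ _ _ h', ← add_assoc,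
      padSeq_inner _ _ _ _ _ _ _ (show m + 3 + i < m + 3 + m' by omega)]
    exact Fin.append_right (Fin.append w ![x, y, z]) w' ⟨i, h'⟩
  obtain ⟨i, rfl⟩ := Nat.exists_eq_add_of_le h'
  rw [show m + 3 + (m' + i + 3) = m + 3 + m' + 3 + i by ring,
    show m' + i + 3 = m' + 3 + i by ring, padSeq_last, padSeq_last]

/-- Triples as sequences of length three. -/
def tripleEquiv (V : Type*) : V × V × V ≃ (Fin 3 → V) where
  toFun t := ![t.1, t.2.1, t.2.2]
  invFun f := (f 0, f 1, f 2)
  left_inv _ := rfl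
  right_inv f := by
    funext i
    fin_cases i <;> rfl

namespace LinkSystem

variable {V : Type*} [Fintype V] {α β : ℝ} {k : ℕ}

/-- For fixed `v`, the event `yz ∈ R_{xv}` has density at least `15/16 · 4/9 = 5/12`, where `15/16`
allows for `x ≠ v`. This exceeds `1/3`, so it meets its cyclic rotation with density at least `5/12
- 1/3 = 1/12`. -/
theorem proportion_two_good_ge [Nonempty V] (S : LinkSystem V α β k)
    (hn : 1 / (Fintype.card V : ℝ) ≤ 1 / 16) (v : V) :
    1 / 12 ≤ proportion (fun t : V × V × V => S.G t.1 v t.2.1 t.2.2 ∧ S.G t.2.2 v t.1 t.2.1) := by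
  have h₁ : 15 / 16 ≤ proportion (fun x : V => x ≠ v) := by
    have := proportion_sub_le (fun _ : V => True) (fun x => x ≠ v)
    simp only [true_and, not_not] at this
    rw [proportion_true, proportion_eq_right] at this
    linarith
  have h₂ := proportion_prod_ge (Q := fun x (e : V × V) => S.G x v e.1 e.2) (by norm_num) h₁
    fun x hx => S.many hx
  have h₃ : 15 / 16 * (4 / 9) ≤ proportion (fun t : V × V × V => S.G t.1 v t.2.1 t.2.2) :=
    h₂.trans (proportion_mono fun t ht => ht.2)
  let e : V × V × V ≃ V × V × V :=
    { toFun := fun t => (t.2.2, t.1, t.2.1)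
      invFun := fun t => (t.2.1, t.2.2, t.1)
      left_inv := fun _ => rfl
      right_inv := fun _ => rfl }
  have h₄ : 3 * proportion (fun t : V × V × V => S.G t.1 v t.2.1 t.2.2) ≤ 1 + 3 *
      proportion (fun t : V × V × V => S.G t.1 v t.2.1 t.2.2 ∧ S.G t.2.2 v t.1 t.2.1) :=
    three_mul_proportion_le e (fun _ => rfl) fun t => S.G t.1 v t.2.1 t.2.2
  linarith

/-- Take quadruples with `xy ∈ R_{zv}` and `yz ∈ R_{xv}`, of density at least `1/12`. If `xy` lies
in `R_{uv}` for few `u`, then few `z` are possible, so discarding these costs `1/48`; likewise for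
`yz`. What remains has density `2 · 1/48`, and averaging over `v` gives the claim. -/
theorem proportion_connectable_ge [Nonempty V] (S : LinkSystem V α β k)
    (hn : 1 / (Fintype.card V : ℝ) ≤ 1 / 16) :
    1 / 48 ≤ proportion (fun t : V × V × V => S.Connectable (1 / 48) t.1 t.2.1 t.2.2) := by
  refine proportion_sections_ge (X := V × V × V) (Y := V)
    (P := fun z => S.E z.1.1 z.1.2.1 z.1.2.2 z.2 ∧
      1 / 48 ≤ proportion (fun u => S.G u z.2 z.1.1 z.1.2.1) ∧
      1 / 48 ≤ proportion (fun u => S.G u z.2 z.1.2.1 z.1.2.2)) (by norm_num) ?_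
  rw [← proportion_swap]
  have h₁ : 1 * (1 / 12) ≤ proportion (fun z : V × V × V × V => True ∧
      (S.G z.2.1 z.1 z.2.2.1 z.2.2.2 ∧ S.G z.2.2.2 z.1 z.2.1 z.2.2.1)) :=
    proportion_prod_ge (P := fun _ : V => True) (Q := fun v (t : V × V × V) =>
      S.G t.1 v t.2.1 t.2.2 ∧ S.G t.2.2 v t.1 t.2.1) (by norm_num) proportion_true.ge
      fun v _ => S.proportion_two_good_ge hn v
  have b₁ : proportion (fun z : V × V × V × V => S.G z.2.2.2 z.1 z.2.1 z.2.2.1 ∧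
      ¬ 1 / 48 ≤ proportion (fun u => S.G u z.1 z.2.1 z.2.2.1)) ≤ 1 / 48 := by
    refine proportion_prod_le (by norm_num) fun v => proportion_prod_le (by norm_num) fun x =>
      proportion_prod_le (by norm_num) fun y => ?_
    by_cases h : 1 / 48 ≤ proportion (fun u => S.G u v x y)
    · rw [proportion_eq_zero fun z hz => hz.2 h]
      norm_num
    · exact (proportion_mono fun z hz => hz.1).trans (not_le.1 h).le
  have b₂ : proportion (fun z : V × V × V × V => S.G z.2.1 z.1 z.2.2.1 z.2.2.2 ∧
      ¬ 1 / 48 ≤ proportion (fun u => S.G u z.1 z.2.2.1 z.2.2.2)) ≤ 1 / 48 := by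
    refine proportion_prod_le (by norm_num) fun v => ?_
    rw [← proportion_swap]
    refine proportion_prod_le (by norm_num) fun e => ?_
    by_cases h : 1 / 48 ≤ proportion (fun u => S.G u v e.1 e.2)
    · rw [proportion_eq_zero fun z hz => hz.2 h]
      norm_num
    · exact (proportion_mono fun z hz => hz.1).trans (not_le.1 h).le
  have h₂ := proportion_le_and_add_not (fun z : V × V × V × V => True ∧
      (S.G z.2.1 z.1 z.2.2.1 z.2.2.2 ∧ S.G z.2.2.2 z.1 z.2.1 z.2.2.1))
    (fun z => 1 / 48 ≤ proportion (fun u => S.G u z.1 z.2.1 z.2.2.1))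
  have h₃ := proportion_le_and_add_not (fun z : V × V × V × V => (True ∧
      (S.G z.2.1 z.1 z.2.2.1 z.2.2.2 ∧ S.G z.2.2.2 z.1 z.2.1 z.2.2.1)) ∧
      1 / 48 ≤ proportion (fun u => S.G u z.1 z.2.1 z.2.2.1))
    (fun z => 1 / 48 ≤ proportion (fun u => S.G u z.1 z.2.2.1 z.2.2.2))
  have b₁' := (proportion_mono fun z hz => ⟨hz.1.2.2, hz.2⟩ :
    proportion (fun z : V × V × V × V => (True ∧
      (S.G z.2.1 z.1 z.2.2.1 z.2.2.2 ∧ S.G z.2.2.2 z.1 z.2.1 z.2.2.1)) ∧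
      ¬ 1 / 48 ≤ proportion (fun u => S.G u z.1 z.2.1 z.2.2.1)) ≤ _).trans b₁
  have b₂' := (proportion_mono fun z hz => ⟨hz.1.1.2.1, hz.2⟩ :
    proportion (fun z : V × V × V × V => ((True ∧
      (S.G z.2.1 z.1 z.2.2.1 z.2.2.2 ∧ S.G z.2.2.2 z.1 z.2.1 z.2.2.1)) ∧
      1 / 48 ≤ proportion (fun u => S.G u z.1 z.2.1 z.2.2.1)) ∧
      ¬ 1 / 48 ≤ proportion (fun u => S.G u z.1 z.2.2.1 z.2.2.2)) ≤ _).trans b₂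
  have h₄ : 2 * (1 / 48) ≤ proportion (fun z : V × V × V × V => ((True ∧
      (S.G z.2.1 z.1 z.2.2.1 z.2.2.2 ∧ S.G z.2.2.2 z.1 z.2.1 z.2.2.1)) ∧
      1 / 48 ≤ proportion (fun u => S.G u z.1 z.2.1 z.2.2.1)) ∧
      1 / 48 ≤ proportion (fun u => S.G u z.1 z.2.2.1 z.2.2.2)) := by
    linarith
  exact h₄.trans (proportion_mono fun z hz =>
    ⟨S.rot (S.rot (S.edge hz.1.1.2.2)), hz.1.2, hz.2⟩)

/-- Any two connectable triples are joined by a proportion `θ` of all sequences of length `m`. -/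
def Connects (S : LinkSystem V α β k) (κ θ : ℝ) (m : ℕ) : Prop :=
  ∀ ⦃a b c x y z : V⦄, S.Connectable κ a b c → S.Connectable κ x y z →
    θ ≤ proportion (fun w : Fin m → V => S.Walk a b c w x y z)

theorem Walk.append {S : LinkSystem V α β k} {m m' : ℕ} {a b c x y z x' y' z' : V} {w : Fin m → V}
    {w' : Fin m' → V} (hw : S.Walk a b c w x y z) (hw' : S.Walk x y z w' x' y' z') :
    S.Walk a b c (Fin.append (Fin.append w ![x, y, z]) w') x' y' z' := by
  intro i hi
  rcases lt_or_ge i (m + 3) with h | h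
  · rw [padSeq_append_left _ _ _ _ _ _ _ _ _ _ _ (by omega),
      padSeq_append_left _ _ _ _ _ _ _ _ _ _ _ (by omega),
      padSeq_append_left _ _ _ _ _ _ _ _ _ _ _ (by omega),
      padSeq_append_left _ _ _ _ _ _ _ _ _ _ _ (by omega)]
    exact hw i h
  · obtain ⟨i, rfl⟩ := Nat.exists_eq_add_of_le h
    simp only [add_assoc (m + 3) i, padSeq_append_right]
    exact hw' i (by omega)

/-- The middle triple ranges over the `1/48`-connectable triples and becomes three further inner
vertices. Repeated vertices are harmless here, as walks are counted rather than paths. -/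
theorem Connects.append [Nonempty V] {S : LinkSystem V α β k} {κ θ θ' : ℝ} {m m' : ℕ}
    (hn : 1 / (Fintype.card V : ℝ) ≤ 1 / 16) (hκ : κ ≤ 1 / 48) (hθ : 0 ≤ θ) (hθ' : 0 ≤ θ')
    (H : S.Connects κ θ m) (H' : S.Connects κ θ' m') :
    S.Connects κ (1 / 48 * (θ * θ')) (m + 3 + m') := by
  intro a b c x y z habc hxyz
  let e : (V × V × V) × ((Fin m → V) × (Fin m' → V)) ≃ (Fin (m + 3 + m') → V) :=
    (Equiv.prodAssoc _ _ _).symm.trans <|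
      (Equiv.prodCongr (((Equiv.prodComm _ _).trans
        (Equiv.prodCongr (Equiv.refl _) (tripleEquiv V))).trans (Fin.appendEquiv m 3))
        (Equiv.refl _)).trans (Fin.appendEquiv (m + 3) m')
  refine le_trans ?_ (proportion_equiv e _).le
  refine (proportion_prod_ge
    (P := fun t : V × V × V => S.Connectable (1 / 48) t.1 t.2.1 t.2.2)
    (Q := fun t (w : (Fin m → V) × (Fin m' → V)) => S.Walk a b c w.1 t.1 t.2.1 t.2.2 ∧
      S.Walk t.1 t.2.1 t.2.2 w.2 x y z) (by positivity) (S.proportion_connectable_ge hn)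
      fun t ht => ?_).trans (proportion_mono fun t ht => ht.2.1.append ht.2.2)
  exact proportion_prod_ge (P := fun w => S.Walk a b c w t.1 t.2.1 t.2.2)
    (Q := fun _ w' => S.Walk t.1 t.2.1 t.2.2 w' x y z) hθ' (H habc (ht.mono hκ))
    fun _ _ => H' (ht.mono hκ) hxyz

end LinkSystem

/-! ### From hypergraphs to densities -/

/-- All pairs inside `X ∩ X'` lie in `N ∩ N'` except those missing from `N` or `N'`. With `s = |X|`,
`t = |X'|` and `|X ∩ X'| ≥ s + t - n`, the count simplifies to at least `(1/9 + α)n² - (s - t)²`,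
and `|s - t| ≤ n/3` because both sizes lie between `2n/3` and `n`. -/
theorem card_inter_ge {U : Type*} [Fintype U] [DecidableEq U] {α : ℝ} {X X' : Finset U}
    {N N' : Finset (U × U)} (hN : N ⊆ X ×ˢ X) (hN' : N' ⊆ X' ×ˢ X')
    (hX : 2 / 3 * (Fintype.card U : ℝ) ≤ X.card) (hX' : 2 / 3 * (Fintype.card U : ℝ) ≤ X'.card)
    (h : (5 / 9 + α / 2) * (Fintype.card U : ℝ) ^ 2 - ((Fintype.card U : ℝ) - X.card) ^ 2 ≤ N.card)
    (h' : (5 / 9 + α / 2) * (Fintype.card U : ℝ) ^ 2 - ((Fintype.card U : ℝ) - X'.card) ^ 2 ≤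
      N'.card) :
    α * (Fintype.card U : ℝ) ^ 2 ≤ (N ∩ N').card := by
  have h₁ : (X ∩ X') ×ˢ (X ∩ X') ⊆ (N ∩ N') ∪ ((X ×ˢ X) \ N ∪ (X' ×ˢ X') \ N') := by
    intro z hz
    simp only [mem_product, mem_inter, mem_union, mem_sdiff] at hz ⊢
    tauto
  have h₂ := (card_le_card h₁).trans ((card_union_le _ _).trans
    (Nat.add_le_add_left (card_union_le _ _) _))
  rw [card_product] at h₂
  have h₃ := card_sdiff_add_card_eq_card hN
  have h₄ := card_sdiff_add_card_eq_card hN'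
  rw [card_product] at h₃ h₄
  have h₅ := card_inter_add_card_union X X'
  have h₆ := card_le_univ (X ∪ X')
  have h₇ := card_le_univ X
  have h₈ := card_le_univ X'
  have g₂ : ((X ∩ X').card : ℝ) * (X ∩ X').card ≤ (N ∩ N').card +
    (((X ×ˢ X) \ N).card + ((X' ×ˢ X') \ N').card) := by exact_mod_cast h₂
  have g₃ : (((X ×ˢ X) \ N).card : ℝ) + N.card = X.card * X.card := by exact_mod_cast h₃
  have g₄ : (((X' ×ˢ X') \ N').card : ℝ) + N'.card = X'.card * X'.card := by exact_mod_cast h₄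
  have g₅ : (X.card : ℝ) + X'.card - Fintype.card U ≤ (X ∩ X').card := by
    have : X.card + X'.card ≤ (X ∩ X').card + Fintype.card U := by omega
    have : (X.card : ℝ) + X'.card ≤ (X ∩ X').card + Fintype.card U := by exact_mod_cast this
    linarith
  have g₇ : (X.card : ℝ) ≤ Fintype.card U := by exact_mod_cast h₇
  have g₈ : (X'.card : ℝ) ≤ Fintype.card U := by exact_mod_cast h₈
  generalize (Fintype.card U : ℝ) = n at *
  generalize (X.card : ℝ) = s at *
  generalize (X'.card : ℝ) = t at *
  generalize ((X ∩ X').card : ℝ) = i at *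
  have hn : 0 ≤ n := by linarith
  have g₉ : (s + t - n) * (s + t - n) ≤ i * i := mul_self_le_mul_self (by linarith) g₅
  have hst : (s - t) ^ 2 ≤ (n / 3) ^ 2 := sq_le_sq' (by linarith) (by linarith)
  nlinarith

theorem append_ofFn_eq_map_pathSeq {T : Type*} {k : ℕ} (x : T) (w : Fin k → T) (y : T) :
    [x] ++ List.ofFn w ++ [y] = (List.range (k + 2)).map (pathSeq x w y) := by
  apply List.ext_getElem
  · simp
  · intro i h₁ h₂
    simp only [List.length_map, List.length_range] at h₂
    simp only [List.getElem_map, List.getElem_range, List.getElem_append, pathSeq,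
      List.length_append, List.length_singleton, List.length_ofFn, List.getElem_ofFn,
      List.getElem_singleton]
    split_ifs <;> first | rfl | omega

theorem append_ofFn_eq_map_padSeq {T : Type*} {m : ℕ} (a b c x y z : T) (w : Fin m → T) :
    [a, b, c] ++ List.ofFn w ++ [x, y, z] = (List.range (m + 6)).map (padSeq a b c w x y z) := by
  apply List.ext_getElem
  · simp
  · intro i h₁ h₂
    simp only [List.length_map, List.length_range] at h₂
    rw [List.getElem_map, List.getElem_range]
    rcases lt_or_ge i 3 with h | h
    · interval_cases i <;> rfl
    obtain ⟨i, rfl⟩ := Nat.exists_eq_add_of_le' h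
    rcases lt_or_ge i m with h' | h'
    · rw [padSeq_inner _ _ _ _ _ _ _ h', List.getElem_append_left (by simp; omega),
        List.getElem_append_right (by simp)]
      simp
    obtain ⟨i, rfl⟩ := Nat.exists_eq_add_of_le h'
    have h₃ : i < 3 := by omega
    rw [List.getElem_append_right (by simp)]
    simp only [show m + i + 3 = m + 3 + i by ring, padSeq_last]
    have : ([a, b, c] ++ List.ofFn w).length = m + 3 := by simp
    simp only [this, Nat.add_sub_cancel_left]
    interval_cases i <;> rfl

theorem infix_map_range {T : Type*} (f : ℕ → T) {i k N : ℕ} (h : i + k ≤ N) :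
    (List.range' i k).map f <:+: (List.range N).map f := by
  refine List.IsInfix.map f ⟨List.range' 0 i, List.range' (i + k) (N - (i + k)), ?_⟩
  rw [List.range_eq_range']
  conv_rhs => rw [show N = i + (k + (N - (i + k))) by omega, ← List.range'_append_1,
    ← List.range'_append_1]
  simp

theorem exists_of_infix_map_range {T : Type*} {f : ℕ → T} {N : ℕ} {s : List T}
    (h : s <:+: (List.range N).map f) :
    ∃ i, i + s.length ≤ N ∧ s = (List.range' i s.length).map f := by
  obtain ⟨l₁, l₂, h⟩ := h
  have hl := congrArg List.length h
  simp only [List.length_append, List.length_map, List.length_range] at hl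
  refine ⟨l₁.length, by omega, List.ext_getElem (by simp) fun t h₁ h₂ => ?_⟩
  have e : (l₁ ++ s ++ l₂)[l₁.length + t]'(by simp; omega) = s[t] := by
    rw [List.getElem_append_left (by simp; omega), List.getElem_append_right (by omega)]
    simp
  rw [← e]
  simp [h]

open Classical in
theorem proportion_mul_card_pow {V : Type*} {m : ℕ} {s : Finset V} (hs₀ : s.Nonempty) (P : (Fin m → s) → Prop) :
    proportion P * (s.card : ℝ) ^ m = ((univ.filter P).card : ℝ) := by
  have : Nonempty s := hs₀.to_subtype
  have hne : (Fintype.card (Fin m → s) : ℝ) ≠ 0 := by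
    exact_mod_cast Fintype.card_ne_zero
  have : (s.card : ℝ) ^ m = Fintype.card (Fin m → s) := by simp
  rw [this, proportion, div_mul_cancel₀ _ hne]

namespace UniformHypergraph

variable {V : Type*} [DecidableEq V]

theorem insert_mem_edges_of_link {k : ℕ} {H : UniformHypergraph (k + 1) V} {v : V} {e : Finset V}
    (h : e ∈ (H.link v).edges) : v ∉ e ∧ insert v e ∈ H.edges := by
  obtain ⟨f, hf, rfl⟩ := mem_image.1 h
  obtain ⟨hf, hv⟩ := mem_filter.1 hf
  exact ⟨notMem_erase _ _, by rwa [insert_erase hv]⟩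

theorem mem_verts_left {R : UniformHypergraph 2 V} {x y : V} (h : {x, y} ∈ R.edges) :
    x ∈ R.verts :=
  R.subset_verts _ h (by simp)

/-- The ordered pairs of vertices in `s` that form an edge of `R`. -/
def orderedEdges (R : UniformHypergraph 2 V) (s : Finset V) : Finset (s × s) :=
  univ.filter fun z => ({z.1.1, z.2.1} : Finset V) ∈ R.edges

theorem two_mul_card_edges_le (R : UniformHypergraph 2 V) {s : Finset V} (h : R.verts ⊆ s) :
    2 * R.edges.card ≤ (R.orderedEdges s).card := by
  have hm : ∀ z ∈ R.orderedEdges s, ({z.1.1, z.2.1} : Finset V) ∈ R.edges := fun z hz =>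
    (mem_filter.1 hz).2
  rw [card_eq_sum_card_fiberwise hm, mul_comm]
  refine card_nsmul_le_sum _ _ 2 fun e he => ?_
  obtain ⟨x, y, hxy, rfl⟩ := card_eq_two.1 (R.card_eq e he)
  have hx : x ∈ s := h (mem_verts_left he)
  have he' : ({y, x} : Finset V) ∈ R.edges := by rwa [pair_comm]
  have hy : y ∈ s := h (mem_verts_left he')
  refine one_lt_card.2 ⟨(⟨x, hx⟩, ⟨y, hy⟩), ?_, (⟨y, hy⟩, ⟨x, hx⟩), ?_, ?_⟩
  · simpa [orderedEdges] using he
  · simpa [orderedEdges, pair_comm y x] using he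
  · simp [hxy]

theorem card_orderedEdges_ge {α μ β : ℝ} {ℓ : ℕ} {G R : UniformHypergraph 2 V} {s : Finset V}
    (hs : G.verts = s) (h : IsRobustPart α μ β ℓ G R) :
    (5 / 9 + α / 2) * (s.card : ℝ) ^ 2 - ((s.card : ℝ) - R.verts.card) ^ 2 ≤
      (R.orderedEdges s).card := by
  subst hs
  have h₁ : (2 * R.edges.card : ℝ) ≤ (R.orderedEdges G.verts).card := by
    exact_mod_cast R.two_mul_card_edges_le h.induced.1
  have := h.card_edges
  linarith

theorem proportion_common_ge {α μ β : ℝ} {ℓ : ℕ} {G G' R R' : UniformHypergraph 2 V}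
    {s : Finset V} (hα : 0 ≤ α) (hs₀ : s.Nonempty) (hs : G.verts = s) (hs' : G'.verts = s)
    (h : IsRobustPart α μ β ℓ G R) (h' : IsRobustPart α μ β ℓ G' R') :
    α ≤ proportion (fun z : s × s => ({z.1.1, z.2.1} : Finset V) ∈ R.edges ∧
      ({z.1.1, z.2.1} : Finset V) ∈ R'.edges) := by
  have e₁ := card_orderedEdges_ge hs h
  have e₁' := card_orderedEdges_ge hs' h'
  have key : ∀ {G R : UniformHypergraph 2 V}, G.verts = s → IsRobustPart α μ β ℓ G R →
      (univ.filter fun x : s => x.1 ∈ R.verts).card = R.verts.card ∧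
        R.orderedEdges s ⊆ (univ.filter fun x : s => x.1 ∈ R.verts) ×ˢ
          (univ.filter fun x : s => x.1 ∈ R.verts) ∧
        2 / 3 * (s.card : ℝ) ≤ R.verts.card := by
    intro G R hs h
    refine ⟨?_, fun z hz => ?_, ?_⟩
    · refine card_bij (fun x _ => x.1) (fun x hx => (mem_filter.1 hx).2)
        (fun x _ y _ e => Subtype.ext e) fun x hx => ⟨⟨x, hs ▸ h.induced.1 hx⟩, by simpa using hx, rfl⟩
    · have hz' := (mem_filter.1 hz).2
      simp only [mem_product, mem_filter, mem_univ, true_and]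
      exact ⟨mem_verts_left hz', mem_verts_left (by rwa [pair_comm])⟩
    · have := h.card_verts
      rw [hs] at this
      nlinarith [Nat.cast_nonneg (α := ℝ) s.card]
  obtain ⟨a₁, a₂, a₃⟩ := key hs h
  obtain ⟨b₁, b₂, b₃⟩ := key hs' h'
  have := card_inter_ge (α := α) a₂ b₂ (by rwa [a₁, Fintype.card_coe]) (by rwa [b₁, Fintype.card_coe])
    (by rwa [a₁, Fintype.card_coe]) (by rwa [b₁, Fintype.card_coe])
  have hpos : 0 < (s.card : ℝ) := by exact_mod_cast hs₀.card_pos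
  rw [proportion, Fintype.card_prod, Fintype.card_coe, le_div_iff₀ (by positivity)]
  rw [Fintype.card_coe] at this
  push_cast
  rw [← pow_two]
  refine this.trans (le_of_eq ?_)
  congr 2
  ext z
  simp [orderedEdges]

theorem proportion_edges_ge {α μ β : ℝ} {ℓ : ℕ} {G R : UniformHypergraph 2 V}
    {s : Finset V} (hα : 0 ≤ α) (hs₀ : s.Nonempty) (hs : G.verts = s)
    (h : IsRobustPart α μ β ℓ G R) :
    4 / 9 ≤ proportion (fun z : s × s => ({z.1.1, z.2.1} : Finset V) ∈ R.edges) := by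
  have e₁ := card_orderedEdges_ge hs h
  have e₂ := h.card_edges'
  have hpos : 0 < (s.card : ℝ) := by exact_mod_cast hs₀.card_pos
  rw [hs] at e₂
  rw [proportion, Fintype.card_prod, Fintype.card_coe, le_div_iff₀ (by positivity)]
  have e₃ : 4 / 9 * (s.card : ℝ) ^ 2 ≤ (R.orderedEdges s).card := by
    have : 0 ≤ α * (s.card : ℝ) ^ 2 := by positivity
    linarith
  push_cast
  rw [← pow_two]
  refine e₃.trans (le_of_eq ?_)
  congr 2
  ext z
  simp [orderedEdges]

theorem numPaths_le_card {k m : ℕ} (H : UniformHypergraph k V) {s : Finset V} (hs₀ : s.Nonempty)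
    (hs : H.verts ⊆ s) (p q : List V) (P : (Fin m → s) → Prop)
    (hP : ∀ w : Fin m → s, H.IsPath (p ++ List.ofFn (fun i => (w i : V)) ++ q) → P w) :
    (H.numPaths p q m : ℝ) ≤ proportion P * (s.card : ℝ) ^ m := by
  classical
  rw [proportion_mul_card_pow hs₀]
  norm_cast
  refine (Set.ncard_le_ncard (t := ((univ.filter P).image fun w i => (w i : V) : Finset (Fin m → V)))
    (fun w hw => ?_) (finite_toSet _)).trans ?_
  · have hmem : ∀ i, w i ∈ s := fun i => hs (hw.1.1 _ (by simp))
    simp only [coe_image, coe_filter, mem_univ, true_and]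
    exact ⟨fun i => ⟨w i, hmem i⟩, hP _ hw, rfl⟩
  · rw [Set.ncard_coe_finset]
    exact card_image_le

theorem le_numPaths {k m : ℕ} (H : UniformHypergraph k V) {s : Finset V} (hs₀ : s.Nonempty)
    (hs : H.verts = s) (p q : List V) (P : (Fin m → s) → Prop)
    (hP : ∀ w : Fin m → s, P w → H.IsPath (p ++ List.ofFn (fun i => (w i : V)) ++ q)) :
    proportion P * (s.card : ℝ) ^ m ≤ H.numPaths p q m := by
  classical
  rw [proportion_mul_card_pow hs₀]
  norm_cast
  have hinj : Function.Injective (fun (w : Fin m → s) i => (w i : V)) := fun w w' h =>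
    funext fun i => Subtype.ext (congrFun h i)
  rw [← card_image_of_injective _ hinj, ← Set.ncard_coe_finset]
  refine Set.ncard_le_ncard (fun w hw => ?_) ?_
  · simp only [coe_image, coe_filter, mem_univ, true_and] at hw
    obtain ⟨w, hw, rfl⟩ := hw
    exact hP w hw
  · refine (Set.finite_range fun (w : Fin m → s) i => (w i : V)).subset fun w hw => ?_
    exact ⟨fun i => ⟨w i, hs ▸ hw.1.1 _ (by simp)⟩, rfl⟩

end UniformHypergraph

/-! ### Sequences with repetitions -/

theorem proportion_exists_le {ι X : Type*} [Fintype X] (s : Finset ι) (P : ι → X → Prop) :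
    proportion (fun x => ∃ i ∈ s, P i x) ≤ ∑ i ∈ s, proportion (P i) := by
  classical
  induction s using Finset.induction_on with
  | empty => simpa using (proportion_eq_zero fun _ => id).le
  | insert a s ha ih =>
    rw [sum_insert ha]
    have h := proportion_or_add_proportion_and (P a) (fun x => ∃ i ∈ s, P i x)
    have h' := proportion_nonneg (fun x => P a x ∧ ∃ i ∈ s, P i x)
    have e : proportion (fun x => ∃ i ∈ insert a s, P i x) =
        proportion (fun x => P a x ∨ ∃ i ∈ s, P i x) :=
      proportion_congr fun x => by simp
    linarith

theorem proportion_apply_eq {V : Type*} [Fintype V] [Nonempty V] {m : ℕ} (i : Fin m) (v : V) :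
    proportion (fun w : Fin m → V => w i = v) = 1 / (Fintype.card V : ℝ) := by
  rw [← proportion_eq_right v, ← proportion_equiv (Equiv.funUnique Unit V) (fun y => y = v)]
  exact proportion_comp_injective (σ := fun _ : Unit => i) (fun _ _ _ => rfl)
    (fun f : Unit → V => f () = v)

theorem proportion_apply_eq_apply {V : Type*} [Fintype V] [Nonempty V] {m : ℕ} {i j : Fin m}
    (hij : i ≠ j) :
    proportion (fun w : Fin m → V => w i = w j) ≤ 1 / (Fintype.card V : ℝ) := by
  have hσ : Function.Injective ![i, j] := by
    intro a b h
    fin_cases a <;> fin_cases b <;> simp_all [eq_comm]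
  have h₁ : proportion (fun w : Fin m → V => w i = w j) =
      proportion (fun f : Fin 2 → V => f 0 = f 1) :=
    proportion_comp_injective hσ (fun f : Fin 2 → V => f 0 = f 1)
  have h₂ : proportion (fun f : Fin 2 → V => f 0 = f 1) =
      proportion (fun z : V × V => z.1 = z.2) :=
    proportion_equiv (finTwoArrowEquiv V) (fun z : V × V => z.1 = z.2)
  rw [h₁, h₂]
  refine proportion_prod_le (by positivity) fun x => le_of_eq ?_
  rw [← proportion_eq_right x]
  exact proportion_congr fun y => eq_comm

/-- The proportion of sequences that have a repetition or meet a given list is `O(1 / |V|)`. -/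
theorem proportion_not_nodup_le {V : Type*} [Fintype V] [Nonempty V] {m : ℕ} {p q : List V}
    (hpq : (p ++ q).Nodup) :
    proportion (fun w : Fin m → V => ¬ (p ++ List.ofFn w ++ q).Nodup) ≤
      ((m : ℝ) * m + m * (p ++ q).length) * (1 / (Fintype.card V : ℝ)) := by
  classical
  have h₁ : proportion (fun w : Fin m → V => ∃ e ∈ univ.filter (fun e : Fin m × Fin m => e.1 ≠ e.2),
      w e.1 = w e.2) ≤ (m : ℝ) * m * (1 / (Fintype.card V : ℝ)) := by
    refine (proportion_exists_le _ _).trans ((sum_le_card_nsmul _ _ _ fun e he =>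
      proportion_apply_eq_apply (mem_filter.1 he).2).trans ?_)
    rw [nsmul_eq_mul]
    gcongr
    have := card_filter_le (univ : Finset (Fin m × Fin m)) (fun e => e.1 ≠ e.2)
    simp only [card_univ, Fintype.card_prod, Fintype.card_fin] at this
    exact_mod_cast this
  have h₂ : proportion (fun w : Fin m → V => ∃ e ∈ (univ : Finset (Fin m)) ×ˢ (p ++ q).toFinset,
      w e.1 = e.2) ≤ (m : ℝ) * (p ++ q).length * (1 / (Fintype.card V : ℝ)) := by
    refine (proportion_exists_le _ _).trans ((sum_le_card_nsmul _ _ _ fun e he =>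
      (proportion_apply_eq e.1 e.2).le).trans ?_)
    rw [nsmul_eq_mul, card_product, card_univ, Fintype.card_fin, Nat.cast_mul]
    gcongr
    exact List.toFinset_card_le _
  rw [add_mul]
  refine le_trans ?_ (add_le_add h₁ h₂)
  rw [← proportion_or_add_proportion_and]
  refine le_add_of_le_of_nonneg (proportion_mono fun w hw => ?_) (proportion_nonneg _)
  by_contra hcon
  push Not at hcon
  obtain ⟨c₁, c₂⟩ := hcon
  apply hw
  have hinj : Function.Injective w := fun i j hij => by
    by_contra hne
    exact c₁ (i, j) (by simpa using hne) hij
  have hnot : ∀ i, w i ∉ p ++ q := fun i hi => c₂ (i, w i) (by simpa using hi) rfl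
  simp only [List.mem_append, not_or] at hnot
  rw [List.nodup_append] at hpq
  rw [List.append_assoc, List.nodup_append, List.nodup_append, List.nodup_ofFn]
  refine ⟨hpq.1, ⟨hinj, hpq.2.1, ?_⟩, ?_⟩
  · intro a ha b hb hab
    obtain ⟨i, rfl⟩ := (List.mem_ofFn' w a).1 ha
    exact (hnot i).2 (hab ▸ hb)
  · intro a ha b hb hab
    rcases List.mem_append.1 hb with hb | hb
    · obtain ⟨i, rfl⟩ := (List.mem_ofFn' w b).1 hb
      exact (hnot i).1 (hab ▸ ha)
    · exact hpq.2.2 a ha b hb hab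

/-! ### The link system of a hypergraph -/

namespace UniformHypergraph

variable {V : Type*} [DecidableEq V]

theorem insert_insert_mem_edges {k : ℕ} {H : UniformHypergraph (k + 2) V} {u v : V} {e : Finset V}
    (h : e ∈ (H.pairLink u v).edges) : insert u (insert v e) ∈ H.edges :=
  (insert_mem_edges_of_link (insert_mem_edges_of_link h).2).2

/-- The system of graphs `R_{uv}` in a 4-uniform hypergraph. -/
def linkSystem (H : UniformHypergraph 4 V) (R : Sym2 V → UniformHypergraph 2 V) {α μ β : ℝ} {k : ℕ}
    (hα : 0 ≤ α) (hβ : 0 ≤ β) (hV : H.verts.Nonempty)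
    (hR : ∀ u ∈ H.verts, ∀ v ∈ H.verts, u ≠ v →
      IsRobustPart α μ β (k + 1) (H.pairLink u v) (R s(u, v))) :
    LinkSystem H.verts α (β * (2 / 3) ^ k) k where
  E a b c d := ({a.1, b.1, c.1, d.1} : Finset V) ∈ H.edges
  G u v p q := u ≠ v ∧ ({p.1, q.1} : Finset V) ∈ (R s(u.1, v.1)).edges
  rot := by
    intro a b c d h
    convert h using 1
    ext t
    simp only [mem_insert, mem_singleton]
    tauto
  ne h := h.1
  symm h := ⟨h.1, by rw [pair_comm]; exact h.2⟩
  swap h := ⟨h.1.symm, by rw [Sym2.eq_swap]; exact h.2⟩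
  edge := by
    intro u v p q h
    have hp := hR u.1 u.2 v.1 v.2 (fun e => h.1 (Subtype.ext e))
    exact insert_insert_mem_edges ((hp.induced.2 _).1 h.2).1
  common := by
    intro u v u' v' h h'
    refine (proportion_common_ge hα hV rfl rfl
      (hR u.1 u.2 v.1 v.2 fun e => h (Subtype.ext e))
      (hR u'.1 u'.2 v'.1 v'.2 fun e => h' (Subtype.ext e))).trans
      (proportion_mono fun z hz => ⟨⟨h, hz.1⟩, ⟨h', hz.2⟩⟩)
  many := by
    intro u v h
    exact (proportion_edges_ge hα hV rfl (hR u.1 u.2 v.1 v.2 fun e => h (Subtype.ext e))).trans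
      (proportion_mono fun z hz => ⟨h, hz⟩)
  robust := by
    intro u v x x' y y' hx hy hxy
    have hp := hR u.1 u.2 v.1 v.2 (fun e => hx.1 (Subtype.ext e))
    have h₁ := hp.robust x.1 (mem_verts_left hx.2) y.1 (mem_verts_left hy.2)
      (fun e => hxy (Subtype.ext e))
    rw [Nat.add_sub_cancel] at h₁
    have h₂ := numPaths_le_card (m := k) (R s(u.1, v.1)) hV hp.induced.1 [x.1] [y.1]
      (fun w : Fin k → H.verts => ∀ i ≤ k, u ≠ v ∧ ({(pathSeq x w y i).1,
        (pathSeq x w y (i + 1)).1} : Finset V) ∈ (R s(u.1, v.1)).edges) ?_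
    · have hpos : 0 < (H.verts.card : ℝ) := by exact_mod_cast hV.card_pos
      -- Robustness counts relative to `|V(R_{uv})|`, densities relative to `n`; the ratio is at
      -- least `2/3`, which is the origin of the factor `(2/3)^k`.
      have h₃ : 2 / 3 * (H.verts.card : ℝ) ≤ (R s(u.1, v.1)).verts.card := by
        have : (2 / 3 + α / 2) * (H.verts.card : ℝ) ≤ _ := hp.card_verts
        nlinarith
      have h₄ : β * (2 / 3 * (H.verts.card : ℝ)) ^ k ≤ β * ((R s(u.1, v.1)).verts.card : ℝ) ^ k := by
        gcongr
      rw [mul_pow, ← mul_assoc] at h₄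
      exact le_of_mul_le_mul_right (h₄.trans (h₁.trans h₂)) (by positivity)
    · intro w hw i hi
      refine ⟨hx.1, ?_⟩
      rw [append_ofFn_eq_map_pathSeq] at hw
      have := hw.1.2 _ (infix_map_range _ (i := i) (k := 2) (by omega)) (by simp)
      simpa [List.range'_succ, map_pathSeq Subtype.val, Function.comp_def] using this

/-- Connectability of pairs is measured against the `n - 1` vertices of the reduced link; halving
`ζ` absorbs the change to `n`, since `n - 1 ≥ n/2`. -/
theorem connectable_linkSystem {H : UniformHypergraph 4 V} {R : Sym2 V → UniformHypergraph 2 V}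
    {α μ β ζ : ℝ} {k : ℕ} (hα : 0 ≤ α) (hβ : 0 ≤ β) (hV : H.verts.Nonempty)
    (hR : ∀ u ∈ H.verts, ∀ v ∈ H.verts, u ≠ v →
      IsRobustPart α μ β (k + 1) (H.pairLink u v) (R s(u, v)))
    (hζ : 0 ≤ ζ) (hn : 2 ≤ H.verts.card) {a b c : V} (ha : a ∈ H.verts) (hb : b ∈ H.verts)
    (hc : c ∈ H.verts) (h : H.TripleConnectable R ζ a b c) :
    (H.linkSystem R hα hβ hV hR).Connectable (ζ / 2) ⟨a, ha⟩ ⟨b, hb⟩ ⟨c, hc⟩ := by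
  classical
  have hpos : 0 < (H.verts.card : ℝ) := by exact_mod_cast hV.card_pos
  have hn' : (2 : ℝ) ≤ H.verts.card := by exact_mod_cast hn
  have pair : ∀ (v x y : H.verts), (H.reducedLink v.1).PairConnectable (fun u => R s(u, v.1)) ζ x y →
      ζ / 2 ≤ proportion (fun u => (H.linkSystem R hα hβ hV hR).G u v x y) := by
    intro v x y hxy
    have h₁ := hxy.2.2.2
    have e : (H.reducedLink v.1).verts = H.verts.erase v.1 := rfl
    rw [e, card_erase_of_mem v.2, Nat.cast_sub (by omega), Nat.cast_one] at h₁
    rw [proportion, Fintype.card_coe, le_div_iff₀ hpos]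
    have h₂ : ((H.verts.erase v.1).filter
        fun u => ({x.1, y.1} : Finset V) ∈ (R s(u, v.1)).edges).card ≤
        (univ.filter fun u => (H.linkSystem R hα hβ hV hR).G u v x y).card := by
      refine card_le_card_of_surjOn Subtype.val fun u hu => ?_
      obtain ⟨hu₁, hu₂⟩ := mem_filter.1 (mem_coe.1 hu)
      obtain ⟨hu₃, hu₄⟩ := mem_erase.1 hu₁
      refine ⟨⟨u, hu₄⟩, ?_, rfl⟩
      simp only [coe_filter, mem_univ, true_and]
      exact ⟨fun e => hu₃ (congrArg Subtype.val e), hu₂⟩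
    have h₃ : (_ : ℝ) ≤ _ := Nat.cast_le.2 h₂
    refine le_trans ?_ (h₁.trans h₃)
    nlinarith
  have h₁ := h.2.2.2
  rw [LinkSystem.Connectable, proportion, Fintype.card_coe, le_div_iff₀ hpos]
  refine le_trans (by nlinarith) (h₁.trans (Nat.cast_le.2 ?_))
  refine card_le_card_of_surjOn Subtype.val fun v hv => ?_
  obtain ⟨hv₁, hv₂, hv₃, hv₄⟩ := mem_filter.1 (mem_coe.1 hv)
  refine ⟨⟨v, hv₁⟩, ?_, rfl⟩
  simp only [coe_filter, mem_univ, true_and]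
  refine ⟨?_, pair ⟨v, hv₁⟩ ⟨a, ha⟩ ⟨b, hb⟩ hv₃, pair ⟨v, hv₁⟩ ⟨b, hb⟩ ⟨c, hc⟩ hv₄⟩
  have := (insert_mem_edges_of_link (mem_filter.1 hv₂).1).2
  change ({a, b, c, v} : Finset V) ∈ H.edges
  convert this using 1
  ext t
  simp only [mem_insert, mem_singleton]
  tauto

/-- As `ζ > 0`, the triple is a bridge for some `v`, hence an edge of a 3-uniform hypergraph. -/
theorem TripleConnectable.nodup {H : UniformHypergraph 4 V} {R : Sym2 V → UniformHypergraph 2 V}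
    {ζ : ℝ} (hζ : 0 < ζ) (hV : H.verts.Nonempty) {a b c : V} (h : H.TripleConnectable R ζ a b c) :
    [a, b, c].Nodup := by
  classical
  have hpos : 0 < (H.verts.card : ℝ) := by exact_mod_cast hV.card_pos
  have h₁ := (mul_pos hζ hpos).trans_le h.2.2.2
  obtain ⟨v, hv⟩ := card_pos.1 (Nat.cast_pos.1 h₁)
  have h₂ := (H.reducedLink v).card_eq _ (mem_filter.1 hv).2.1
  rw [← Multiset.coe_nodup, ← Multiset.toFinset_card_eq_card_iff_nodup]
  simpa using h₂

theorem proportion_walk_le_numPaths {H : UniformHypergraph 4 V} {R : Sym2 V → UniformHypergraph 2 V}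
    {α μ β : ℝ} {k m : ℕ} (hα : 0 ≤ α) (hβ : 0 ≤ β) (hV : H.verts.Nonempty)
    (hR : ∀ u ∈ H.verts, ∀ v ∈ H.verts, u ≠ v →
      IsRobustPart α μ β (k + 1) (H.pairLink u v) (R s(u, v))) {a b c x y z : H.verts}
    (hd : [a, b, c, x, y, z].Nodup) :
    (proportion (fun w : Fin m → H.verts =>
        (H.linkSystem R hα hβ hV hR).Walk a b c w x y z) -
      ((m : ℝ) * m + m * 6) * (1 / (H.verts.card : ℝ))) * (H.verts.card : ℝ) ^ m ≤
    H.numPaths [a.1, b.1, c.1] [x.1, y.1, z.1] m := by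
  have : Nonempty H.verts := hV.to_subtype
  refine le_trans ?_ (H.le_numPaths hV rfl _ _ (fun w : Fin m → H.verts =>
    (H.linkSystem R hα hβ hV hR).Walk a b c w x y z ∧
      ([a, b, c] ++ List.ofFn w ++ [x, y, z]).Nodup) fun w hw => ?_)
  · gcongr
    have h₁ := proportion_not_nodup_le (m := m) (p := [a, b, c]) (q := [x, y, z]) hd
    have h₂ := proportion_sub_le (fun w : Fin m → H.verts =>
      (H.linkSystem R hα hβ hV hR).Walk a b c w x y z)
      (fun w => ([a, b, c] ++ List.ofFn w ++ [x, y, z]).Nodup)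
    rw [Fintype.card_coe] at h₁
    have h₃ : (([a, b, c] ++ [x, y, z]).length : ℝ) = 6 := by norm_num
    rw [h₃] at h₁
    linarith
  · have e : [a.1, b.1, c.1] ++ List.ofFn (fun i => (w i).1) ++ [x.1, y.1, z.1] =
        ([a, b, c] ++ List.ofFn w ++ [x, y, z]).map Subtype.val := by
      simp [List.map_ofFn, Function.comp_def]
    rw [e]
    refine ⟨⟨fun v hv => ?_, fun s hs hs' => ?_⟩, hw.2.map Subtype.val_injective⟩
    · obtain ⟨v, _, rfl⟩ := List.mem_map.1 hv
      exact v.2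
    · rw [append_ofFn_eq_map_padSeq, List.map_map] at hs
      obtain ⟨i, hi, hs⟩ := exists_of_infix_map_range hs
      rw [hs'] at hi hs
      have := hw.1 i (by omega)
      rw [hs]
      simpa [List.range'_succ, linkSystem] using this

end UniformHypergraph

/-! ### Constants and conclusion -/

/-- The proportion of connecting walks guaranteed by concatenating `j + 1` basic connections. -/
noncomputable def connConst (α β κ : ℝ) (h : ℕ) : ℕ → ℝ
  | 0 => (κ * κ * (κ * κ / 2) * (α / 2) * (α / 2) * β ^ 3) ^ ((12 * h + 10) ^ Fintype.card (Letter h))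
  | j + 1 => 1 / 48 * (connConst α β κ h j * connConst α β κ h 0)

theorem connConst_pos {α β κ : ℝ} (hα : 0 < α) (hβ : 0 < β) (hκ : 0 < κ) (h j : ℕ) :
    0 < connConst α β κ h j := by
  have h₀ : 0 < connConst α β κ h 0 := by
    unfold connConst
    positivity
  induction j with
  | zero => exact h₀
  | succ j ih =>
    unfold connConst
    positivity

theorem LinkSystem.connects {V : Type*} [Fintype V] [Nonempty V] {α β κ : ℝ} {h : ℕ}
    (S : LinkSystem V α β (2 * h)) (hα : 0 < α) (hβ : 0 < β) (hκ : 0 < κ) (hκ' : κ ≤ 1 / 48)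
    (h₁ : 1 / (Fintype.card V : ℝ) ≤ κ * κ / 2) (h₂ : 1 / (Fintype.card V : ℝ) ≤ α / 4)
    (h₃ : 1 / (Fintype.card V : ℝ) ≤ 1 / 16) (j : ℕ) :
    S.Connects κ (connConst α β κ h j) (12 * h + 10 + j * (12 * h + 13)) := by
  have base : S.Connects κ (connConst α β κ h 0) (12 * h + 10) := fun a b c x y z habc hxyz => by
    rw [connConst]
    exact (pow_le_pow_left₀ (by positivity)
      (S.proportion_letters_ge hκ hα hβ.le habc hxyz h₁ h₂) _).trans
      (S.proportion_walk_ge_of_letters a b c x y z)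
  induction j with
  | zero => simpa using base
  | succ j ih =>
    have := ih.append h₃ hκ' (connConst_pos hα hβ hκ h j).le (connConst_pos hα hβ hκ h 0).le base
    rw [connConst]
    rwa [show 12 * h + 10 + j * (12 * h + 13) + 3 + (12 * h + 10) =
      12 * h + 10 + (j + 1) * (12 * h + 13) by ring] at this

end

theorem mainTheorem3 (ℓ : ℕ) (hℓ : 3 ≤ ℓ) (hodd : Odd ℓ) :
    ∃ L : ℕ → ℕ,
      (∀ i ∈ Finset.Icc 1 4, L i ≤ 50 * ℓ ∧ L i ≡ i [MOD 4]) ∧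
      ∀ α β ζ : ℝ, 0 < α → α < 1 / 3 → 0 < β → 0 < ζ →
        ∃ θ : ℝ, 0 < θ ∧ ∃ n₀ : ℕ,
          ∀ (V : Type*) [DecidableEq V] (H : UniformHypergraph 4 V)
            (R : Sym2 V → UniformHypergraph 2 V),
            n₀ ≤ H.verts.card →
            (5 / 9 + α) * ((H.verts.card : ℝ) ^ 2 / 2) ≤ (H.minDegree 2 : ℝ) →
            (∀ u ∈ H.verts, ∀ v ∈ H.verts, u ≠ v →
              UniformHypergraph.IsRobustPart α (α ^ 3 / 18) β ℓ (H.pairLink u v) (R s(u, v))) →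
            ∀ a b c x y z : V,
              H.TripleConnectable R ζ a b c →
              H.TripleConnectable R ζ x y z →
              Disjoint ({a, b, c} : Finset V) {x, y, z} →
              ∀ i ∈ Finset.Icc 1 4,
                θ * (H.verts.card : ℝ) ^ L i ≤
                  (H.numPaths [a, b, c] [x, y, z] (L i) : ℝ) := by
  obtain ⟨h, rfl⟩ := hodd
  -- One connection has `12h + 10 ≡ 2` inner vertices modulo 4 and each further one adds `12h + 13 ≡
  -- 1`, so `i - 2 ≡ i + 2` extra connections are needed. At most three are used, giving at most
  -- `48h + 49`.
  let L : ℕ → ℕ := fun i => 12 * h + 10 + (i + 2) % 4 * (12 * h + 13)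
  have hL : ∀ i ∈ Finset.Icc 1 4, L i ≤ 50 * (2 * h + 1) ∧ L i ≡ i [MOD 4] := by
    intro i hi
    obtain ⟨h₁, h₂⟩ := Finset.mem_Icc.1 hi
    simp only [L, Nat.ModEq]
    interval_cases i <;> norm_num <;> omega
  refine ⟨L, hL, fun α β ζ hα _ hβ hζ => ?_⟩
  -- One threshold that fits both the given end triples and the intermediate ones.
  set κ : ℝ := min (ζ / 2) (1 / 48) with hκdef
  set β' : ℝ := β * (2 / 3) ^ (2 * h) with hβ'
  have hκ : 0 < κ := lt_min (by positivity) (by norm_num)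
  have hβ'pos : 0 < β' := by positivity
  obtain ⟨Θ, hΘ, hΘ'⟩ : ∃ Θ : ℝ, 0 < Θ ∧ ∀ j < 4, Θ ≤ connConst α β' κ h j := by
    refine ⟨(Finset.range 4).inf' ⟨0, by simp⟩ (connConst α β' κ h),
      (Finset.lt_inf'_iff _).2 fun j _ => connConst_pos hα hβ'pos hκ h j, fun j hj =>
      Finset.inf'_le _ (Finset.mem_range.2 hj)⟩
  set M : ℝ := ((50 * (2 * h + 1) : ℕ) : ℝ) with hM
  have hMpos : 0 < M := by
    rw [hM]
    exact_mod_cast (by omega : 0 < 50 * (2 * h + 1))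
  -- The required upper bound on `1/n`: the first three terms serve the walk count, and the last
  -- keeps sequences with repeated vertices below half of the density `Θ`.
  set ε : ℝ := min (min (κ * κ / 2) (α / 4)) (min (1 / 16) (Θ / 2 / (M * M + M * 6))) with hε
  have hεpos : 0 < ε := by
    refine lt_min (lt_min ?_ ?_) (lt_min ?_ ?_) <;> positivity
  refine ⟨Θ / 2, by positivity, ⌈1 / ε⌉₊ + 2, ?_⟩
  intro V _ H R hn _ hR a b c x y z habc hxyz hdisj i hi
  have hcard : 2 ≤ H.verts.card := by omega
  have hV : H.verts.Nonempty := Finset.card_pos.1 (by omega)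
  have hpos : 0 < (H.verts.card : ℝ) := by exact_mod_cast hV.card_pos
  have hnε : 1 / (H.verts.card : ℝ) ≤ ε := by
    rw [one_div_le hpos hεpos]
    refine (Nat.le_ceil _).trans ?_
    exact_mod_cast (by omega : ⌈1 / ε⌉₊ ≤ H.verts.card)
  have : Nonempty H.verts := hV.to_subtype
  let S := H.linkSystem R hα.le hβ.le hV hR
  have hc₁ := UniformHypergraph.connectable_linkSystem hα.le hβ.le hV hR hζ.le hcard habc.1
    habc.2.1 habc.2.2.1 habc
  have hc₂ := UniformHypergraph.connectable_linkSystem hα.le hβ.le hV hR hζ.le hcard hxyz.1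
    hxyz.2.1 hxyz.2.2.1 hxyz
  have hε₁ : ε ≤ κ * κ / 2 := (min_le_left _ _).trans (min_le_left _ _)
  have hε₂ : ε ≤ α / 4 := (min_le_left _ _).trans (min_le_right _ _)
  have hε₃ : ε ≤ 1 / 16 := (min_le_right _ _).trans (min_le_left _ _)
  have hε₄ : ε ≤ Θ / 2 / (M * M + M * 6) := (min_le_right _ _).trans (min_le_right _ _)
  have hwalk := S.connects hα hβ'pos hκ (min_le_right _ _)
    (by rw [Fintype.card_coe]; exact hnε.trans hε₁) (by rw [Fintype.card_coe]; exact hnε.trans hε₂)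
    (by rw [Fintype.card_coe]; exact hnε.trans hε₃) ((i + 2) % 4)
    (hc₁.mono (min_le_left _ _)) (hc₂.mono (min_le_left _ _))
  have hd : [a, b, c, x, y, z].Nodup := by
    refine (List.nodup_append (l₁ := [a, b, c]) (l₂ := [x, y, z])).2
      ⟨habc.nodup hζ hV, hxyz.nodup hζ hV, fun s hs t ht hst => ?_⟩
    exact Finset.disjoint_left.1 hdisj (by simpa using hs) (by simpa [hst] using ht)
  have hfin := UniformHypergraph.proportion_walk_le_numPaths (m := L i) hα.le hβ.le hV hR
    (a := ⟨a, habc.1⟩) (b := ⟨b, habc.2.1⟩) (c := ⟨c, habc.2.2.1⟩) (x := ⟨x, hxyz.1⟩)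
    (y := ⟨y, hxyz.2.1⟩) (z := ⟨z, hxyz.2.2.1⟩)
    (List.Nodup.of_map Subtype.val (by simpa using hd))
  refine le_trans ?_ hfin
  gcongr
  have hLM : (L i : ℝ) ≤ M := Nat.cast_le.2 (hL i hi).1
  have h₁ : ((L i : ℝ) * L i + L i * 6) * (1 / (H.verts.card : ℝ)) ≤ Θ / 2 :=
    calc _ ≤ (M * M + M * 6) * (Θ / 2 / (M * M + M * 6)) := by
          refine mul_le_mul ?_ (hnε.trans hε₄) (by positivity) (by positivity)
          gcongr
      _ = Θ / 2 := mul_div_cancel₀ _ (by positivity)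
  have h₂ := (hΘ' _ (Nat.mod_lt (i + 2) (by norm_num))).trans hwalk
  have h₃ : Θ - Θ / 2 = Θ / 2 := by ring
  rw [← h₃]
  exact sub_le_sub h₂ h₁
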